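/- Let $\mathcal{A}$ be a central arrangement of $n$ distinct hyperplanes in $V=\mathbb{C}^\ell$ with defining linear forms $\alpha_H$ $(H\in\mathcal{A})$, and assume that $\mathcal{A}$ is essential, i.e. the $\alpha_H$ span $V^*$ (so $\mathcal{A}$ has rank $\ell$). Let $R=\mathbb{C}[x_1,\dots,x_\ell]$, let $f=\prod_H\alpha_H$, and let $\Omega^p_V$ be the module of polynomial $p$-forms on $V$. Let $$\Omega^p(\mathcal{A})=\Big\{\omega\in\tfrac1f\Omega^p_V \;\Big|\; \tfrac{d\alpha_H}{\alpha_H}\wedge\omega\in\tfrac1f\Omega^{p+1}_V\text{ for all }H\in\mathcal{A}\Big\}$$ be the $R$-module of logarithmic $p$-forms, and let $\Omega^p_0(\mathcal{A})\subseteq\Omega^p(\mathcal{A})$ be the kernel of contraction with the Euler vector field $\chi=\sum_i x_i\partial_i$. The arrangement $\mathcal{A}$ is called tame if $\operatorname{pd}_R\Omega^p(\mathcal{A})\le p$ for $0\le p\le\ell$, and free if $\Omega^1(\mathcal{A})$ is a free $R$-module. For $\lambda\in\mathbb{C}^{\mathcal{A}}$ put $\omega_\lambda=\sum_H\lambda_H\,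 d\alpha_H/\alpha_H$; if $\sum_H\lambda_H=0$, then multiplication by $\omega_\lambda$ makes $\Omega^\bullet_0(\mathcal{A})$ a cochain complex. Let $\overline{\Sigma}(\mathcal{A})$ be the Zariski closure in $V\times\mathbb{C}^{\mathcal{A}}$ of $$\Sigma(\mathcal{A})=\Big\{(x,\lambda)\;\Big|\; x\in V\setminus\bigcup_{H\in\mathcal{A}}H,\ \omega_\lambda(x)=0\Big\},$$ and let $\overline{\Sigma}_\lambda(\mathcal{A})=\{x\in V\mid (x,\lambda)\in\overline{\Sigma}(\mathcal{A})\}$. Suppose that $\mathcal{A}$ is tame, let $\lambda\in\mathbb{C}^{\mathcal{A}}$ satisfy $\sum_H\lambda_H=0$, let $p\ge 0$ be an integer, and suppose that at least one of the following holds: $\mathcal{A}$ has rank at most $4$; $\mathcal{A}$ is free; $p\le 2$. If $H^p(\Omega^\bullet_0(\mathcal{A}),\omega_\lambda)\neq 0$, then $\overline{\Sigma}_\lambda(\mathcal{A})$ has codimension at most $p$ in $V$. (The codimension of an algebraic set is the smallest codimension of one of its irreducible components, and is $\infty$ for the empty set; in particular $\overline{\Sigma}_\lambda(\mathcal{A})\neq\emptyset$.)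 -/

import Mathlib

/-- A central simple arrangement of `n` hyperplanes in `V = ℂ^ℓ`, given by defining linear forms:
`coeff H` is the coefficient vector of the form `α_H`, and the hyperplane is `H = ker α_H`.
The forms are nonzero, and distinct indices give distinct hyperplanes. -/
structure CentralArrangement (l n : ℕ) where
  coeff : Fin n → Fin l → ℂ
  coeff_ne_zero : ∀ H, coeff H ≠ 0
  simple : ∀ H H', H ≠ H' → LinearIndependent ℂ ![coeff H, coeff H']

/-- The coordinate ring `R = Sym(V*) = ℂ[x_1, …, x_ℓ]`. -/
abbrev CoordRing (l : ℕ) : Type := MvPolynomial (Fin l) ℂ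

/-- The field of rational functions on `V`. -/
abbrev RatFun (l : ℕ) : Type := FractionRing (CoordRing l)

/-- Rational differential forms on `V` (of all degrees): the exterior algebra, over the rational
functions, of the vector space with basis `dx_1, …, dx_ℓ`. The product is the wedge product. -/
abbrev RatForm (l : ℕ) : Type := ExteriorAlgebra (RatFun l) (Fin l → RatFun l)

noncomputable section

/-- The differential `dx_i` of the `i`-th coordinate. -/
def dCoord {l : ℕ} (i : Fin l) : RatForm l :=
  ExteriorAlgebra.ι (RatFun l) (Pi.single i 1)

/-- The `R`-module `Ω^p_V` of polynomial `p`-forms, spanned by the forms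
`dx_{i_1} ∧ ⋯ ∧ dx_{i_p}`. -/
def polyForms (l p : ℕ) : Submodule (CoordRing l) (RatForm l) :=
  Submodule.span (CoordRing l)
    (Set.range fun i : Fin p → Fin l => (List.ofFn fun k => dCoord (i k)).prod)

/-- Contraction `ι_χ` of rational forms with the Euler vector field `χ = ∑ x_i ∂_i`, i.e. the
antiderivation, linear over the rational functions, with `ι_χ(dx_i) = x_i`. -/
def eulerContraction (l : ℕ) : RatForm l →ₗ[RatFun l] RatForm l :=
  CliffordAlgebra.contractLeft
    (Fintype.linearCombination (RatFun l)
      fun i : Fin l => algebraMap (CoordRing l) (RatFun l) (MvPolynomial.X i))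

namespace CentralArrangement

variable {l n : ℕ} (A : CentralArrangement l n)

/-- The rank of the arrangement: the dimension of the span of its defining forms, i.e. the
codimension of the intersection of all hyperplanes. -/
def rank : ℕ := Module.finrank ℂ (Submodule.span ℂ (Set.range A.coeff))

/-- The arrangement is essential: its defining forms span `V*`, so that `ℓ` of them can be taken as
coordinates on `V`. -/
def IsEssential : Prop := Submodule.span ℂ (Set.range A.coeff) = ⊤

/-- The defining form `α_H` as a polynomial. -/
def linForm (H : Fin n) : CoordRing l :=
  ∑ i, MvPolynomial.C (A.coeff H i) * MvPolynomial.X i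

/-- The defining polynomial `f = ∏ α_H`. -/
def defPoly : CoordRing l := ∏ H, A.linForm H

/-- The logarithmic form `dα_H / α_H`. -/
def dlog (H : Fin n) : RatForm l :=
  (algebraMap (CoordRing l) (RatFun l) (A.linForm H))⁻¹ •
    ∑ i, algebraMap ℂ (RatFun l) (A.coeff H i) • dCoord i

/-- The module `Ω^p(𝒜)` of logarithmic `p`-forms: the rational forms `ω` with `f ω ∈ Ω^p_V` and
`f (dα_H / α_H) ∧ ω ∈ Ω^{p+1}_V` for every `H`. -/
def logForms (p : ℕ) : Submodule (CoordRing l) (RatForm l) :=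
  (polyForms l p).comap (LinearMap.lsmul (CoordRing l) (RatForm l) A.defPoly) ⊓
    ⨅ H, (polyForms l (p + 1)).comap
      (LinearMap.lsmul (CoordRing l) (RatForm l) A.defPoly ∘ₗ
        LinearMap.mulLeft (CoordRing l) (A.dlog H))

/-- The module `Ω^p_0(𝒜)` of relative logarithmic `p`-forms: the logarithmic forms killed by
contraction with the Euler vector field. -/
def relLogForms (p : ℕ) : Submodule (CoordRing l) (RatForm l) :=
  A.logForms p ⊓ (LinearMap.ker (eulerContraction l)).restrictScalars (CoordRing l)

/-- The arrangement is tame: `pd_R Ω^p(𝒜) ≤ p` for `0 ≤ p ≤ ℓ`. -/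
def IsTame : Prop :=
  ∀ p ≤ l, CategoryTheory.HasProjectiveDimensionLE
    (ModuleCat.of (CoordRing l) (A.logForms p)) p

/-- The arrangement is free: `Ω^1(𝒜)` is a free `R`-module. -/
def IsFree : Prop := Module.Free (CoordRing l) (A.logForms 1)

/-- The logarithmic `1`-form `ω_λ = ∑ λ_H dα_H / α_H`. -/
def omega (lam : Fin n → ℂ) : RatForm l :=
  ∑ H, algebraMap ℂ (RatFun l) (lam H) • A.dlog H

/-- Multiplication `η ↦ ω_λ ∧ η`, the differential of the complex. -/
def wedgeOmega (lam : Fin n → ℂ) : RatForm l →ₗ[CoordRing l] RatForm l :=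
  LinearMap.mulLeft (CoordRing l) (A.omega lam)

/-- The cocycles of degree `p` of `(Ω^•_0(𝒜), ω_λ)`. -/
def cocycles (lam : Fin n → ℂ) (p : ℕ) : Submodule (CoordRing l) (RatForm l) :=
  A.relLogForms p ⊓ LinearMap.ker (A.wedgeOmega lam)

/-- The coboundaries of degree `p` of `(Ω^•_0(𝒜), ω_λ)`; they are zero in degree `0`. -/
def coboundaries (lam : Fin n → ℂ) : ℕ → Submodule (CoordRing l) (RatForm l)
  | 0 => ⊥
  | p + 1 => (A.relLogForms p).map (A.wedgeOmega lam)

/-- The cohomology `H^p(Ω^•_0(𝒜), ω_λ)`. For `∑ λ_H = 0` multiplication by `ω_λ` maps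
`Ω^p_0(𝒜)` to `Ω^{p+1}_0(𝒜)`, so that this is the cohomology of a complex. -/
abbrev Cohomology (lam : Fin n → ℂ) (p : ℕ) : Type :=
  A.cocycles lam p ⧸ (A.coboundaries lam p).submoduleOf (A.cocycles lam p)

/-- The value `ω_λ(x)`, a covector, at a point `x` outside all hyperplanes. -/
def omegaAt (lam : Fin n → ℂ) (x : Fin l → ℂ) : Fin l → ℂ :=
  ∑ H, (lam H / MvPolynomial.eval x (A.linForm H)) • A.coeff H

/-- The set `Σ(𝒜)` of pairs `(x, λ)` in `V × ℂ^𝒜`, with `x` outside all hyperplanes, such that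
`ω_λ(x) = 0`. The pair `(x, λ)` is the point `Sum.elim x λ` of affine `(ℓ + n)`-space. -/
def critSet : Set (Fin l ⊕ Fin n → ℂ) :=
  {z | ∃ (x : Fin l → ℂ) (lam : Fin n → ℂ), z = Sum.elim x lam ∧
    (∀ H, MvPolynomial.eval x (A.linForm H) ≠ 0) ∧ A.omegaAt lam x = 0}

/-- The Zariski closure of `Σ(𝒜)` in `V × ℂ^𝒜`. -/
def critVariety : Set (Fin l ⊕ Fin n → ℂ) :=
  MvPolynomial.zeroLocus ℂ (MvPolynomial.vanishingIdeal ℂ A.critSet)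

/-- The fibre over `λ` of the Zariski closure of `Σ(𝒜)`, as an algebraic subset of `V`. -/
def critFiber (lam : Fin n → ℂ) : Set (Fin l → ℂ) :=
  {x | Sum.elim x lam ∈ A.critVariety}

end CentralArrangement

/-- The codimension in `ℂ^ℓ` of an algebraic subset: the height of its vanishing ideal, i.e. the
smallest codimension of an irreducible component, and `∞` for the empty set. -/
def algCodim {l : ℕ} (Z : Set (Fin l → ℂ)) : ℕ∞ :=
  (MvPolynomial.vanishingIdeal ℂ Z : Ideal (CoordRing l)).height

end

-- The proof works first with indeterminate weights. Let `S = R[a_H]` and consider the generic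
-- complex `S ⊗ Ω^•(𝒜)` with differential `∑ a_H dα_H/α_H ∧`. By tameness and flatness its terms
-- have projective dimension at most their degree, and it vanishes above degree ℓ. If θ is a
-- logarithmic derivation with `θ(α_H) = c_H α_H`, then by Cartan's formula contraction with θ is a
-- homotopy for multiplication by `∑ c_H a_H`. So the ideal `logIdeal` generated by all these
-- elements kills the cohomology.
--
-- The zero locus of `logIdeal` has codimension at least ℓ, and its part over `f = 0` has
-- codimension at least ℓ + 1 (`exists_generators`). Off `f = 0` it lies in Σ (`mem_critSet`). By
-- the acyclicity lemma (`mem_boundaries_of_smul_mem`), an associated prime of the first nonzero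
-- cohomology, say in degree p, contains no regular sequence of length p + 1. Hence the cohomology
-- sits in degree ℓ, and no component of its support lies over `f = 0`. The support is therefore
-- contained in the closure of Σ, and every function vanishing on Σ has a power killing the generic
-- cohomology.
--
-- This property survives setting `a_H = λ_H` one weight at a time, at the cost of a larger exponent
-- (`exists_pow_smul_mem_boundaries_subst`). By the Nullstellensatz, functions vanishing on the
-- fibre over λ then act nilpotently on the cohomology of `(Ω^•(𝒜), ω_λ)`. A second use of the
-- acyclicity lemma, now over `R`, makes this complex exact in all degrees below the codimension of
-- the fibre. Since `∑ λ_H = 0`, contraction with the Euler field turns a primitive of a relative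
-- form into a relative primitive, so the exactness passes to `Ω^•_0(𝒜)`.

universe u

/-! ### Grade, projective dimension and the acyclicity lemma. -/

section Homological

open CategoryTheory Abelian RingTheory.Sequence

variable {R : Type u} [CommRing R]

theorem shortExact_ofHom {A B C : Type u} [AddCommGroup A] [AddCommGroup B] [AddCommGroup C]
    [Module R A] [Module R B] [Module R C] {f : A →ₗ[R] B} {g : B →ₗ[R] C}
    (hf : Function.Injective f) (hfg : Function.Exact f g) (hg : Function.Surjective g) :
    (ShortComplex.mk (ModuleCat.ofHom f) (ModuleCat.ofHom g)
      (by ext x; exact hfg.apply_apply_eq_zero x)).ShortExact where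
  exact := (ShortComplex.ShortExact.moduleCat_exact_iff_function_exact _).mpr hfg
  mono_f := (ModuleCat.mono_iff_injective _).mpr hf
  epi_g := (ModuleCat.epi_iff_surjective _).mpr hg

/-- Dimension shifting in the covariant variable of `Ext`. -/
theorem subsingleton_ext_of_exact {A B C : Type u} [AddCommGroup A] [AddCommGroup B]
    [AddCommGroup C] [Module R A] [Module R B] [Module R C] {f : A →ₗ[R] B} {g : B →ₗ[R] C}
    (hf : Function.Injective f) (hfg : Function.Exact f g) (hg : Function.Surjective g)
    (N : ModuleCat.{u} R) {i : ℕ} (hB : Subsingleton (Ext N (ModuleCat.of R B) i))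
    (hA : Subsingleton (Ext N (ModuleCat.of R A) (i + 1))) :
    Subsingleton (Ext N (ModuleCat.of R C) i) := by
  refine subsingleton_of_forall_eq 0 fun x => ?_
  obtain ⟨y, rfl⟩ := Ext.covariant_sequence_exact₃ N (shortExact_ofHom hf hfg hg) x rfl
    (hA.elim _ _)
  rw [show y = 0 from hB.elim _ _, Ext.zero_comp]

/-- If `M` admits a weakly regular sequence of length `c` in the annihilator of `N`, then
`Ext^i(N, M) = 0` for `i < c`. -/
theorem subsingleton_ext_of_isWeaklyRegular (N : ModuleCat.{u} R) (M : ModuleCat.{u} R)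
    (rs : List R) (hrs : ∀ r ∈ rs, r ∈ Module.annihilator R N) (reg : IsWeaklyRegular M rs)
    (i : ℕ) (hi : i < rs.length) : Subsingleton (Ext N M i) := by
  induction rs generalizing M i with
  | nil => simp at hi
  | cons a rs ih =>
    rw [isWeaklyRegular_cons_iff] at reg
    have ha := hrs a List.mem_cons_self
    refine subsingleton_of_forall_eq 0 fun x => ?_
    -- An element killing `N` kills every `Ext(N, -)`. So `x` dies under multiplication by `a` on
    -- `M`, and for positive degree it comes from `Ext(N, M/aM)` one degree lower.
    have hz : x.comp (Ext.mk₀ (M.smulShortComplex a).f) (add_zero i) = 0 := by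
      rw [ModuleCat.smulShortComplex_f_eq_smul_id]
      exact congr($(Ext.postcomp_smul_id_eq_zero_of_mem_annihilator (M := M) ha i) x)
    rcases i with _ | i
    · have : Mono (M.smulShortComplex a).f :=
        (IsSMulRegular.smulShortComplex_shortExact reg.1).mono_f
      exact Ext.postcomp_mk₀_injective_of_mono N (M.smulShortComplex a).f
        (hz.trans (map_zero ((Ext.mk₀ (M.smulShortComplex a).f).postcomp N (add_zero 0))).symm)
    · obtain ⟨y, rfl⟩ := Ext.covariant_sequence_exact₁ N
        (IsSMulRegular.smulShortComplex_shortExact reg.1) x hz rfl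
      have := ih (ModuleCat.of R (QuotSMulTop a M))
        (fun r hr => hrs r (List.mem_cons_of_mem _ hr)) reg.2 i (by simpa using hi)
      rw [show y = 0 from this.elim _ _]
      exact Ext.zero_comp ..

theorem isWeaklyRegular_of_flat_module {rs : List R} (reg : IsWeaklyRegular R rs) (F : Type u)
    [AddCommGroup F] [Module R F] [Module.Flat R F] : IsWeaklyRegular F rs :=
  ((TensorProduct.rid R F).isWeaklyRegular_congr rs).mp
    (reg.isWeaklyRegular_lTensor (M₂ := F))

/-- The grade of an ideal on a module drops from that on the ring by at most the projective
dimension of the module. -/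
theorem subsingleton_ext_of_hasProjectiveDimensionLE (N : ModuleCat.{u} R) (rs : List R)
    (hrs : ∀ r ∈ rs, r ∈ Module.annihilator R N) (reg : IsWeaklyRegular R rs) (j : ℕ)
    (M : Type u) [AddCommGroup M] [Module R M]
    (hM : HasProjectiveDimensionLE (ModuleCat.of R M) j) (i : ℕ) (hi : i + j < rs.length) :
    Subsingleton (Ext N (ModuleCat.of R M) i) := by
  induction j generalizing M i with
  | zero =>
    have := (projective_iff_hasProjectiveDimensionLE_zero _).mpr hM
    have : Module.Projective R M := (IsProjective.iff_projective M).mpr this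
    exact subsingleton_ext_of_isWeaklyRegular N _ rs hrs (isWeaklyRegular_of_flat_module reg M) i hi
  | succ j ih =>
    -- Passing to the kernel of a free cover lowers the projective dimension by one and raises the
    -- `Ext` index by one, so `i + j` is unchanged.
    let π : (M →₀ R) →ₗ[R] M := Finsupp.linearCombination R id
    have hπ : Function.Surjective π := Finsupp.linearCombination_id_surjective R M
    have hex : Function.Exact (LinearMap.ker π).subtype π := LinearMap.exact_subtype_ker_map π
    have hs := shortExact_ofHom (R := R) (A := LinearMap.ker π) (B := M →₀ R) (C := M)
      (f := (LinearMap.ker π).subtype) (g := π) (LinearMap.ker π).injective_subtype hex hπ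
    have hK : HasProjectiveDimensionLE (ModuleCat.of R (LinearMap.ker π)) j := by
      have : Projective (ModuleCat.of R (M →₀ R)) :=
        (IsProjective.iff_projective _).mp inferInstance
      exact (hs.hasProjectiveDimensionLT_X₃_iff j this).mp hM
    exact subsingleton_ext_of_exact (f := (LinearMap.ker π).subtype) (g := π)
      (LinearMap.ker π).injective_subtype hex hπ N
      (subsingleton_ext_of_isWeaklyRegular N _ rs hrs (isWeaklyRegular_of_flat_module reg _) i
        (by omega)) (ih _ hK _ (by omega))

/-- Projective dimension does not increase under flat base change. -/
theorem hasProjectiveDimensionLE_baseChange (S : Type u) [CommRing S] [Algebra R S]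
    [Module.Flat R S] (j : ℕ) (M : Type u) [AddCommGroup M] [Module R M]
    (hM : HasProjectiveDimensionLE (ModuleCat.of R M) j) :
    HasProjectiveDimensionLE (ModuleCat.of S (TensorProduct R S M)) j := by
  induction j generalizing M with
  | zero =>
    have := (projective_iff_hasProjectiveDimensionLE_zero _).mpr hM
    have : Module.Projective R M := (IsProjective.iff_projective M).mpr this
    exact (projective_iff_hasProjectiveDimensionLE_zero _).mp
      ((IsProjective.iff_projective _).mp inferInstance)
  | succ j ih =>
    let π : (M →₀ R) →ₗ[R] M := Finsupp.linearCombination R id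
    have hπ : Function.Surjective π := Finsupp.linearCombination_id_surjective R M
    have hex : Function.Exact (LinearMap.ker π).subtype π := LinearMap.exact_subtype_ker_map π
    have hs := shortExact_ofHom (R := R) (A := LinearMap.ker π) (B := M →₀ R) (C := M)
      (f := (LinearMap.ker π).subtype) (g := π) (LinearMap.ker π).injective_subtype hex hπ
    have hK : HasProjectiveDimensionLE (ModuleCat.of R (LinearMap.ker π)) j := by
      have : Projective (ModuleCat.of R (M →₀ R)) :=
        (IsProjective.iff_projective _).mp inferInstance
      exact (hs.hasProjectiveDimensionLT_X₃_iff j this).mp hM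
    have hex' := Module.Flat.lTensor_exact (R := R) S (N := LinearMap.ker π) (N' := M →₀ R)
      (N'' := M) (f := (LinearMap.ker π).subtype) (g := π) hex
    have hs' := shortExact_ofHom (R := S) (f := (LinearMap.ker π).subtype.baseChange S)
      (g := π.baseChange S)
      (Module.Flat.lTensor_preserves_injective_linearMap _ (LinearMap.ker π).injective_subtype)
      hex' (LinearMap.lTensor_surjective S hπ)
    have : Projective (ModuleCat.of S (TensorProduct R S (M →₀ R))) :=
      (IsProjective.iff_projective _).mp inferInstance
    exact (hs'.hasProjectiveDimensionLT_X₃_iff j this).mpr (ih _ hK)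

variable {M : ℕ → Type u} [∀ p, AddCommGroup (M p)] [∀ p, Module R (M p)]

/-- The coboundaries of a sequence of maps, zero in degree `0`. -/
def boundaries (d : ∀ p, M p →ₗ[R] M (p + 1)) : ∀ p, Submodule R (M p)
  | 0 => ⊥
  | p + 1 => LinearMap.range (d p)

/-- A form of the acyclicity lemma of Peskine and Szpiro. -/
theorem mem_boundaries_of_smul_mem (d : ∀ p, M p →ₗ[R] M (p + 1))
    (hd : ∀ p z, d (p + 1) (d p z) = 0)
    (hM : ∀ p, HasProjectiveDimensionLE (ModuleCat.of R (M p)) p) (i : ℕ)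
    (hex : ∀ j < i, ∀ z, d j z = 0 → z ∈ boundaries d j) (Q : Ideal R) (rs : List R)
    (hlen : i < rs.length) (hrs : ∀ r ∈ rs, r ∈ Q) (reg : IsWeaklyRegular R rs) (z : M i)
    (hz : ∀ q ∈ Q, q • z ∈ boundaries d i) : z ∈ boundaries d i := by
  set N := ModuleCat.of R (R ⧸ Q)
  have hann : ∀ r ∈ rs, r ∈ Module.annihilator R N := by
    intro r hr
    change r ∈ Module.annihilator R (R ⧸ Q)
    rw [Ideal.annihilator_quotient]
    exact hrs r hr
  -- Exactness below `i` splices the complex into `0 → B^j → M^j → B^(j+1) → 0`. Starting from `B^0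
  -- = 0`, each step costs one `Ext` index.
  have key : ∀ j ≤ i, ∀ m, m + j ≤ rs.length →
      Subsingleton (Ext N (ModuleCat.of R (boundaries d j)) m) := by
    intro j
    induction j with
    | zero =>
      intro _ m _
      have : Limits.IsZero (ModuleCat.of R (boundaries d 0)) := by
        rw [ModuleCat.isZero_iff_subsingleton]
        exact inferInstanceAs (Subsingleton (⊥ : Submodule R (M 0)))
      refine subsingleton_of_forall_eq 0 fun x => ?_
      rw [← x.comp_mk₀_id, this.eq_of_src (𝟙 _) 0, Ext.mk₀_zero, Ext.comp_zero]
    | succ j ih =>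
      intro hj m hm
      have hle : ∀ x : boundaries d j, d j x = 0 := by
        rintro ⟨x, hx⟩
        rcases j with _ | j
        · simp [(Submodule.mem_bot R).mp hx]
        · obtain ⟨y, rfl⟩ := hx
          exact hd j y
      refine subsingleton_ext_of_exact (f := (boundaries d j).subtype) (g := (d j).rangeRestrict)
        (boundaries d j).injective_subtype ?_ (d j).surjective_rangeRestrict N
        (subsingleton_ext_of_hasProjectiveDimensionLE N rs hann reg j _ (hM j) m (by omega))
        (ih (by omega) (m + 1) (by omega))
      intro x
      constructor
      · intro hx
        exact ⟨⟨x, hex j (by omega) x (congrArg Subtype.val hx)⟩, rfl⟩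
      · rintro ⟨y, rfl⟩
        exact Subtype.ext (hle y)
  have h1 := key i le_rfl 1 (by omega)
  have h0 := subsingleton_ext_of_hasProjectiveDimensionLE N rs hann reg i _ (hM i) 0 (by omega)
  -- This gives `Hom(R/Q, M^i/B^i) = 0`. The class of `z` is killed by `Q`, so `1 ↦ [z]` is such a
  -- homomorphism.
  have h := subsingleton_ext_of_exact (boundaries d i).injective_subtype
    (LinearMap.exact_subtype_mkQ _) (boundaries d i).mkQ_surjective N h0 h1
  have h' : Subsingleton ((R ⧸ Q) →ₗ[R] (M i ⧸ boundaries d i)) :=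
    ((Ext.addEquiv₀.trans ModuleCat.homAddEquiv).symm.subsingleton_congr).mpr h
  have := congr($(h'.elim (Q.liftQ (LinearMap.toSpanSingleton R _ ((boundaries d i).mkQ z)) (by
    intro q hq
    rw [LinearMap.mem_ker, LinearMap.toSpanSingleton_apply, ← map_smul]
    exact (Submodule.Quotient.mk_eq_zero _).mpr (hz q hq))) 0) (Submodule.Quotient.mk 1))
  rw [Submodule.liftQ_apply, LinearMap.toSpanSingleton_apply, one_smul] at this
  exact (Submodule.Quotient.mk_eq_zero _).mp this

end Homological

/-! ### Nagata's change of variables. -/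

section NagataTransform

open RingTheory.Sequence

open Polynomial MvPolynomial

variable {k : Type u} [Field k] {n : ℕ} (f : MvPolynomial (Fin (n + 1)) k)

/-- The exponents of Nagata's change of variables attached to `f`. -/
abbrev nagataExp (i : Fin (n + 1)) : ℕ := (2 + f.totalDegree) ^ i.1

/-- Nagata's change of variables `X_i ↦ X_i + c X_0 ^ r_i`. -/
noncomputable abbrev nagataHom (c : k) :
    MvPolynomial (Fin (n + 1)) k →ₐ[k] MvPolynomial (Fin (n + 1)) k :=
  aeval fun i ↦ if i = 0 then X 0 else X i + c • X 0 ^ nagataExp f i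

theorem nagataHom_comp_neg (c : k) : (nagataHom f c).comp (nagataHom f (-c)) = AlgHom.id _ _ := by
  rw [comp_aeval, ← MvPolynomial.aeval_X_left]
  ext i v
  cases i using Fin.cases <;> simp

/-- Nagata's change of variables as an automorphism. -/
noncomputable abbrev nagataEquiv := AlgEquiv.ofAlgHom (nagataHom f 1) (nagataHom f (-1))
  (nagataHom_comp_neg f 1) (by simpa using nagataHom_comp_neg f (-1))

variable {f} in
-- The two sums are numbers written in base `2 + f.totalDegree` with the exponents as digits, and
-- digits are unique.
theorem sum_nagataExp_mul_ne {v w : Fin (n + 1) →₀ ℕ} (vlt : ∀ i, v i < 2 + f.totalDegree)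
    (wlt : ∀ i, w i < 2 + f.totalDegree) (ne : v ≠ w) :
    ∑ x : Fin (n + 1), nagataExp f x * v x ≠ ∑ x : Fin (n + 1), nagataExp f x * w x := by
  intro h
  refine ne <| Finsupp.ext <| congrFun <| List.ofFn_inj.mp ?_
  apply Nat.ofDigits_inj_of_len_eq (Nat.lt_add_right f.totalDegree one_lt_two)
    (by simp) (by grind) (by grind)
  simpa only [Nat.ofDigits_eq_sum_mapIdx, List.mapIdx_eq_ofFn, List.get_ofFn, List.length_ofFn,
    Fin.val_cast, mul_comm, List.sum_ofFn] using! h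

theorem degreeOf_zero_nagataEquiv (v : Fin (n + 1) →₀ ℕ) {a : k} (ha : a ≠ 0) :
    ((nagataEquiv f) (monomial v a)).degreeOf 0 = ∑ i : Fin (n + 1), (nagataExp f i) * v i := by
  rw [← natDegree_finSuccEquiv, monomial_eq, Finsupp.prod_pow v fun a ↦ X a]
  simp only [Fin.prod_univ_succ, Fin.sum_univ_succ, map_mul, map_prod, map_pow,
    AlgEquiv.ofAlgHom_apply, MvPolynomial.aeval_C, MvPolynomial.aeval_X, if_pos, Fin.succ_ne_zero,
    ite_false, one_smul, map_add, finSuccEquiv_X_zero, finSuccEquiv_X_succ, algebraMap_eq]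
  have h (i : Fin n) :
      (Polynomial.C (X (R := k) i) + Polynomial.X ^ nagataExp f i.succ) ^ v i.succ ≠ 0 :=
    pow_ne_zero (v i.succ) (leadingCoeff_ne_zero.mp <| by simp [add_comm, leadingCoeff_X_pow_add_C])
  rw [natDegree_mul (by simp [ha]) (mul_ne_zero (by simp) (Finset.prod_ne_zero_iff.mpr
    (fun i _ ↦ h i))), natDegree_mul (by simp) (Finset.prod_ne_zero_iff.mpr (fun i _ ↦ h i)),
    natDegree_prod _ _ (fun i _ ↦ h i), natDegree_finSuccEquiv, degreeOf_C]
  simp only [natDegree_pow, zero_add, natDegree_X, mul_one, nagataExp, Fin.val_zero, pow_zero,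
    one_mul, add_right_inj]
  exact Finset.sum_congr rfl (fun i _ ↦ by
    rw [add_comm (Polynomial.C _), natDegree_X_pow_add_C, mul_comm])

/-- Distinct monomials of `f` acquire distinct degrees in the first variable, so the top one cannot
cancel. -/
theorem degreeOf_nagataEquiv_ne_of_ne {v w : Fin (n + 1) →₀ ℕ} (hv : v ∈ f.support)
    (hw : w ∈ f.support) (ne : v ≠ w) :
    (nagataEquiv f <| monomial v <| coeff v f).degreeOf 0 ≠
    (nagataEquiv f <| monomial w <| coeff w f).degreeOf 0 := by
  rw [degreeOf_zero_nagataEquiv _ _ <| mem_support_iff.mp hv,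
    degreeOf_zero_nagataEquiv _ _ <| mem_support_iff.mp hw]
  refine sum_nagataExp_mul_ne (fun i ↦ ?_) (fun i ↦ ?_) ne <;>
  exact lt_of_le_of_lt ((monomial_le_degreeOf i ‹_›).trans (degreeOf_le_totalDegree f i))
    (by lia)

theorem leadingCoeff_finSuccEquiv_nagataEquiv (v : Fin (n + 1) →₀ ℕ) :
    (finSuccEquiv k n ((nagataEquiv f) ((monomial v) (coeff v f)))).leadingCoeff =
    algebraMap k _ (coeff v f) := by
  rw [monomial_eq, Finsupp.prod_fintype]
  · simp only [map_mul, map_prod, leadingCoeff_mul, leadingCoeff_prod]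
    rw [AlgEquiv.ofAlgHom_apply, algHom_C, algebraMap_eq, finSuccEquiv_apply,
      eval₂Hom_C, RingHom.coe_comp]
    simp only [AlgEquiv.ofAlgHom_apply, Function.comp_apply, leadingCoeff_C, map_pow,
      leadingCoeff_pow, algebraMap_eq]
    have : ∀ j, ((finSuccEquiv k n) ((nagataHom f 1) (X j))).leadingCoeff = 1 := fun j ↦ by
      by_cases h : j = 0
      · simp [h, finSuccEquiv_apply]
      · simp only [aeval_eq_bind₁, bind₁_X_right, if_neg h, one_smul, map_add, map_pow]
        obtain ⟨i, rfl⟩ := Fin.exists_succ_eq.mpr h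
        simp [finSuccEquiv_X_succ, finSuccEquiv_X_zero, add_comm]
    simp only [this, one_pow, Finset.prod_const_one, mul_one]
  exact fun i ↦ pow_zero _

/-- Nagata's change of variables makes `f` monic, up to a unit, in the first variable. -/
theorem isUnit_leadingCoeff_finSuccEquiv_nagataEquiv (fne : f ≠ 0) :
    IsUnit (finSuccEquiv k n (nagataEquiv f f)).leadingCoeff := by
  obtain ⟨v, vin, vs⟩ := Finset.exists_max_image f.support
    (fun v ↦ (nagataEquiv f ((monomial v) (coeff v f))).degreeOf 0) (support_nonempty.mpr fne)
  set h := fun w ↦ (MvPolynomial.monomial w) (coeff w f)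
  simp only [← natDegree_finSuccEquiv] at vs
  replace vs : ∀ x ∈ f.support \ {v}, (finSuccEquiv k n ((nagataEquiv f) (h x))).degree <
      (finSuccEquiv k n ((nagataEquiv f) (h v))).degree := by
    intro x hx
    obtain ⟨h1, h2⟩ := Finset.mem_sdiff.mp hx
    apply degree_lt_degree <| lt_of_le_of_ne (vs x h1) ?_
    simpa only [natDegree_finSuccEquiv]
      using degreeOf_nagataEquiv_ne_of_ne f h1 vin (by simpa using h2)
  have coeff : (finSuccEquiv k n ((nagataEquiv f)
      (h v + ∑ x ∈ f.support \ {v}, h x))).leadingCoeff =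
      (finSuccEquiv k n ((nagataEquiv f) (h v))).leadingCoeff := by
    simp only [map_add, map_sum]
    rw [add_comm]
    apply leadingCoeff_add_of_degree_lt <| (lt_of_le_of_lt <| degree_sum_le _ _) ?_
    have h2 : h v ≠ 0 := by simpa [h] using mem_support_iff.mp vin
    replace h2 : (finSuccEquiv k n ((nagataEquiv f) (h v))) ≠ 0 := fun eq ↦ h2 <|
      by simpa only [map_eq_zero_iff _ (AlgEquiv.injective _)] using eq
    exact (Finset.sup_lt_iff <| Ne.bot_lt (fun x ↦ h2 <| degree_eq_bot.mp x)).mpr vs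
  nth_rw 2 [← f.support_sum_monomial_coeff]
  rw [Finset.sum_eq_add_sum_sdiff_singleton_of_mem vin h]
  rw [leadingCoeff_finSuccEquiv_nagataEquiv] at coeff
  simpa only [coeff, MvPolynomial.algebraMap_eq] using
    (mem_support_iff.mp vin).isUnit.map MvPolynomial.C

end NagataTransform

/-! ### Regular sequences, transcendence degree and height in polynomial rings. -/

section RegularSequences

open RingTheory.Sequence

variable {k : Type u} [Field k]

/-- The ideal `Q` contains a weakly regular sequence of length `c`. -/
def ContainsWeaklyRegular {R : Type u} [CommRing R] (Q : Ideal R) (c : ℕ) : Prop :=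
  ∃ rs : List R, rs.length = c ∧ (∀ r ∈ rs, r ∈ Q) ∧ IsWeaklyRegular R rs

theorem ContainsWeaklyRegular.of_comap {R S : Type u} [CommRing R] [CommRing S] (e : R ≃+* S)
    {Q : Ideal S} {c : ℕ} (h : ContainsWeaklyRegular (Q.comap e) c) :
    ContainsWeaklyRegular Q c := by
  obtain ⟨rs, hlen, hrs, reg⟩ := h
  refine ⟨rs.map e, by simpa using hlen, by simpa using hrs, ?_⟩
  refine (AddEquiv.isWeaklyRegular_congr (e := e.toAddEquiv) ?_).mp reg
  rw [List.forall₂_map_right_iff, List.forall₂_same]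
  intro r _ x
  simp

/-- Weak regularity survives the flat extension `R → R[X]`, and a polynomial with unit leading
coefficient is a nonzerodivisor modulo any ideal extended from `R`. -/
theorem containsWeaklyRegular_polynomial {R : Type u} [CommRing R] {Q : Ideal (Polynomial R)}
    {c : ℕ} (h : ContainsWeaklyRegular (Q.comap Polynomial.C) c) {g : Polynomial R} (hg : g ∈ Q)
    (hu : IsUnit g.leadingCoeff) : ContainsWeaklyRegular Q (c + 1) := by
  obtain ⟨rs, hlen, hrs, reg⟩ := h
  refine ⟨rs.map (algebraMap R (Polynomial R)) ++ [g], by simpa using hlen, ?_, ?_⟩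
  · intro r hr
    rcases List.mem_append.mp hr with hr | hr
    · obtain ⟨s, hs, rfl⟩ := List.mem_map.mp hr
      exact hrs s hs
    · rwa [List.mem_singleton.mp hr]
  · rw [isWeaklyRegular_append_iff]
    refine ⟨reg.of_flat, ?_⟩
    rw [isWeaklyRegular_singleton_iff, ← Ideal.map_ofList]
    set I := Ideal.ofList rs
    rw [smul_eq_mul, Ideal.mul_top]
    rw [isSMulRegular_iff_right_eq_zero_of_smul]
    intro x hx
    obtain ⟨y, rfl⟩ := Submodule.Quotient.mk_surjective _ x
    rw [← Submodule.Quotient.mk_smul, Submodule.Quotient.mk_eq_zero, smul_eq_mul] at hx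
    rw [Submodule.Quotient.mk_eq_zero]
    have hker : ∀ z : Polynomial R, z ∈ I.map (algebraMap R (Polynomial R)) ↔
        z.map (Ideal.Quotient.mk I) = 0 := by
      intro z
      rw [Polynomial.algebraMap_eq, Ideal.mem_map_C_iff, Polynomial.ext_iff]
      simp [Ideal.Quotient.eq_zero_iff_mem]
    rw [hker] at hx ⊢
    rw [Polynomial.map_mul] at hx
    obtain ⟨u, hu⟩ := hu
    have hm : ((Polynomial.C (↑u⁻¹ : R) * g).map (Ideal.Quotient.mk I)).Monic := by
      apply Polynomial.Monic.map
      exact Polynomial.monic_C_mul_of_mul_leadingCoeff_eq_one (by simp [← hu])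
    refine hm.isRegular.left ?_
    simp [mul_assoc, hx]

theorem trdeg_quotient_comap_le {P P' : Type u} [CommRing P] [CommRing P'] [Algebra k P]
    [Algebra k P'] (φ : P' →ₐ[k] P) (Q : Ideal P) :
    Algebra.trdeg k (P' ⧸ Q.comap φ) ≤ Algebra.trdeg k (P ⧸ Q) :=
  trdeg_le_of_injective (Ideal.quotientMapₐ Q φ le_rfl)
    (Ideal.quotientMap_injective' (H := le_rfl) le_rfl)

/-- A prime ideal `Q` of a polynomial ring contains a regular sequence as long as the codimension
of `Q`. -/
theorem containsWeaklyRegular_of_trdeg (m : ℕ) (Q : Ideal (MvPolynomial (Fin m) k)) (c : ℕ)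
    (h : Algebra.trdeg k (MvPolynomial (Fin m) k ⧸ Q) + c ≤ m) : ContainsWeaklyRegular Q c := by
  induction m generalizing c with
  | zero =>
    have : c = 0 := by
      have h' : (c : Cardinal) ≤ (0 : ℕ) := (self_le_add_left _ _).trans h
      simpa using h'
    exact ⟨[], by simp [this], by simp, by simp⟩
  | succ m ih =>
    rcases c with _ | c
    · exact ⟨[], by simp, by simp, by simp⟩
    have hQ : Q ≠ ⊥ := by
      rintro rfl
      rw [(AlgEquiv.quotientBot k (MvPolynomial (Fin (m + 1)) k)).trdeg_eq,
        MvPolynomial.trdeg_of_isDomain] at h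
      simp only [Cardinal.mk_fin, Cardinal.lift_natCast] at h
      norm_cast at h
      omega
    obtain ⟨f, hf, hf0⟩ := Submodule.exists_mem_ne_zero_of_ne_bot hQ
    -- In the coordinates `ψ` the element `f` is monic up to a unit in one variable. Contracting `Q`
    -- to the other `m` variables does not raise the transcendence degree, so induction supplies `c`
    -- elements and `f` is the last one.
    let ψ := (nagataEquiv f).trans (MvPolynomial.finSuccEquiv k m)
    refine ContainsWeaklyRegular.of_comap ψ.symm.toRingEquiv ?_
    refine containsWeaklyRegular_polynomial (g := ψ f) (ih _ c ?_) ?_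
      (isUnit_leadingCoeff_finSuccEquiv_nagataEquiv f hf0)
    · have h1 := trdeg_quotient_comap_le
        (((ψ.symm : Polynomial (MvPolynomial (Fin m) k) →ₐ[k] _)).comp
          ((Algebra.ofId (MvPolynomial (Fin m) k)
            (Polynomial (MvPolynomial (Fin m) k))).restrictScalars k)) Q
      have h2 := (add_le_add_left h1 ((c + 1 : ℕ) : Cardinal)).trans h
      push_cast at h2
      rw [← add_assoc] at h2
      exact Cardinal.add_one_le_add_one_iff.mp h2
    · simpa using hf

/-- If the degrees agreed, a transcendence basis of `B` would lift to one of `A`. A nonzero element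
of the kernel, being algebraic over the subalgebra of the lift, would put a nonzero element of that
subalgebra in the kernel, but `f` is injective there. -/
theorem trdeg_lt_of_surjective {A B : Type u} [CommRing A] [IsDomain A] [CommRing B] [IsDomain B]
    [Algebra k A] [Algebra k B] (f : A →ₐ[k] B) (hf : Function.Surjective f)
    (hf' : ¬ Function.Injective f) (hfin : Algebra.trdeg k A < Cardinal.aleph0) :
    Algebra.trdeg k B < Algebra.trdeg k A := by
  by_contra! hle
  obtain ⟨ι, y, hy⟩ := exists_isTranscendenceBasis' k B
  choose x hx using fun i => hf (y i)
  have hxy : f ∘ x = y := funext hx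
  have hxi : AlgebraicIndependent k x := AlgebraicIndependent.of_comp f (hxy ▸ hy.1)
  have hxb := hxi.isTranscendenceBasis_of_trdeg_le hfin (hy.cardinalMk_eq_trdeg ▸ hle)
  have := hxb.isAlgebraic
  obtain ⟨a, ha, ha0⟩ : ∃ a, f a = 0 ∧ a ≠ 0 := by
    by_contra! H
    exact hf' ((injective_iff_map_eq_zero f).mpr H)
  refine Ideal.comap_ne_bot_of_algebraic_mem (R := Algebra.adjoin k (Set.range x))
    (I := RingHom.ker f) ha0 ha (Algebra.IsAlgebraic.isAlgebraic a) (eq_bot_iff.mpr ?_)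
  rintro ⟨c, hc⟩ hc0
  rw [Algebra.adjoin_range_eq_range_aeval] at hc
  obtain ⟨p, rfl⟩ := hc
  have : MvPolynomial.aeval y p = 0 := by
    rw [← hxy]
    exact (MvPolynomial.comp_aeval_apply x f p).symm.trans hc0
  have hp : p = 0 := hy.1 (by simpa using this)
  subst hp
  exact Subtype.ext (map_zero _)

/-- A bound for the transcendence degree of the quotient by a prime ideal of given height. -/
theorem trdeg_add_le_of_le_height (m : ℕ) (Q : Ideal (MvPolynomial (Fin m) k)) [Q.IsPrime] (c : ℕ)
    (h : (c : ℕ∞) ≤ Q.height) : Algebra.trdeg k (MvPolynomial (Fin m) k ⧸ Q) + c ≤ m := by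
  have hle : ∀ I : Ideal (MvPolynomial (Fin m) k),
      Algebra.trdeg k (MvPolynomial (Fin m) k ⧸ I) ≤ m := by
    intro I
    refine (trdeg_le_of_surjective (Ideal.Quotient.mkₐ k I)
      (Ideal.Quotient.mkₐ_surjective k I)).trans ?_
    simp
  have hlt : ∀ I : Ideal (MvPolynomial (Fin m) k),
      Algebra.trdeg k (MvPolynomial (Fin m) k ⧸ I) < Cardinal.aleph0 :=
    fun I => (hle I).trans_lt Cardinal.natCast_lt_aleph0
  let τ : PrimeSpectrum (MvPolynomial (Fin m) k) → ℕ := fun q =>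
    Cardinal.toNat (Algebra.trdeg k (MvPolynomial (Fin m) k ⧸ q.asIdeal))
  have hτ : ∀ q, (τ q : Cardinal) = Algebra.trdeg k (MvPolynomial (Fin m) k ⧸ q.asIdeal) :=
    fun q => Cardinal.cast_toNat_of_lt_aleph0 (hlt _)
  have hτm : ∀ q, τ q ≤ m := fun q => by
    have := hle q.asIdeal
    rw [← hτ] at this
    exact_mod_cast this
  -- A strictly monotone function to `ℕ` on the primes bounds the height from above.
  have hmono : StrictMono fun q => m - τ q := by
    intro p q hpq
    have hpq' : p.asIdeal < q.asIdeal := hpq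
    have := trdeg_lt_of_surjective (k := k) (Ideal.Quotient.factorₐ k hpq'.le)
      (Ideal.Quotient.factor_surjective hpq'.le) (by
        intro hinj
        obtain ⟨x, hxq, hxp⟩ := Set.exists_of_ssubset hpq'
        refine hxp (Ideal.Quotient.eq_zero_iff_mem.mp (hinj ?_))
        rw [map_zero]
        exact (Ideal.Quotient.factor_mk hpq'.le x).trans (Ideal.Quotient.eq_zero_iff_mem.mpr hxq))
      (hlt _)
    rw [← hτ, ← hτ] at this
    have h1 : τ q < τ p := by exact_mod_cast this
    have := hτm p
    change m - τ p < m - τ q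
    omega
  have h1 := Order.height_le_height_apply_of_strictMono _ hmono ⟨Q, inferInstance⟩
  rw [Order.height_nat, ← PrimeSpectrum.height_eq_orderHeight] at h1
  have h2 : c ≤ m - τ ⟨Q, inferInstance⟩ := by exact_mod_cast h.trans h1
  have h3 := hτm ⟨Q, inferInstance⟩
  have h4 := hτ ⟨Q, inferInstance⟩
  rw [← h4]
  norm_cast
  omega

end RegularSequences

/-! ### From generic weights to special weights. -/

section Specialization

open CategoryTheory RingTheory.Sequence TensorProduct

open MvPolynomial

variable {R : Type u} [CommRing R] {n : ℕ} {M : ℕ → Type u} [∀ p, AddCommGroup (M p)]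
  [∀ p, Module R (M p)]

/-- The differential `∑ w_H e_H` on `S ⊗ M`, for weights `w` in a polynomial ring `S` over `R`. -/
noncomputable def weightedDiff (e : Fin n → ∀ p, M p →ₗ[R] M (p + 1))
    (w : Fin n → MvPolynomial (Fin n) R) (p : ℕ) :
    (MvPolynomial (Fin n) R ⊗[R] M p) →ₗ[MvPolynomial (Fin n) R]
      (MvPolynomial (Fin n) R ⊗[R] M (p + 1)) :=
  ∑ H, w H • (e H p).baseChange (MvPolynomial (Fin n) R)

theorem weightedDiff_apply (e : Fin n → ∀ p, M p →ₗ[R] M (p + 1))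
    (w : Fin n → MvPolynomial (Fin n) R) (p : ℕ) (z : MvPolynomial (Fin n) R ⊗[R] M p) :
    weightedDiff e w p z = ∑ H, w H • (e H p).baseChange (MvPolynomial (Fin n) R) z := by
  simp [weightedDiff, LinearMap.sum_apply]

/-- The substitution of weights in the coefficients of `S ⊗ M`. -/
noncomputable def substWeights (w : Fin n → MvPolynomial (Fin n) R) (p : ℕ) :
    (MvPolynomial (Fin n) R ⊗[R] M p) →ₗ[R] (MvPolynomial (Fin n) R ⊗[R] M p) :=
  (aeval w : MvPolynomial (Fin n) R →ₐ[R] _).toLinearMap.rTensor (M p)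

theorem substWeights_smul (w : Fin n → MvPolynomial (Fin n) R) (p : ℕ)
    (s : MvPolynomial (Fin n) R) (z : MvPolynomial (Fin n) R ⊗[R] M p) :
    substWeights w p (s • z) = aeval w s • substWeights w p z := by
  induction z with
  | zero => simp
  | add x y hx hy => simp only [smul_add, map_add, hx, hy]
  | tmul a m => simp [substWeights, TensorProduct.smul_tmul']

theorem substWeights_baseChange (w : Fin n → MvPolynomial (Fin n) R) (p q : ℕ)
    (f : M p →ₗ[R] M q) (z : MvPolynomial (Fin n) R ⊗[R] M p) :
    substWeights w q (f.baseChange _ z) = f.baseChange _ (substWeights w p z) := by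
  induction z with
  | zero => simp
  | add x y hx hy => simp only [map_add, hx, hy]
  | tmul a m => simp [substWeights]

theorem substWeights_weightedDiff (e : Fin n → ∀ p, M p →ₗ[R] M (p + 1))
    (v w : Fin n → MvPolynomial (Fin n) R) (p : ℕ) (z : MvPolynomial (Fin n) R ⊗[R] M p) :
    substWeights w (p + 1) (weightedDiff e v p z) =
      weightedDiff e (fun H => aeval w (v H)) p (substWeights w p z) := by
  simp only [weightedDiff_apply, map_sum, substWeights_smul, substWeights_baseChange]

theorem substWeights_substWeights (v w : Fin n → MvPolynomial (Fin n) R) (p : ℕ)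
    (z : MvPolynomial (Fin n) R ⊗[R] M p) :
    substWeights w p (substWeights v p z) = substWeights (fun H => aeval w (v H)) p z := by
  induction z with
  | zero => simp
  | add x y hx hy => simp only [map_add, hx, hy]
  | tmul a m =>
    simp only [substWeights, LinearMap.rTensor_tmul, AlgHom.toLinearMap_apply]
    rw [comp_aeval_apply]

theorem substWeights_mem_boundaries (e : Fin n → ∀ p, M p →ₗ[R] M (p + 1))
    (v w : Fin n → MvPolynomial (Fin n) R) (p : ℕ) (z : MvPolynomial (Fin n) R ⊗[R] M p)
    (hz : z ∈ boundaries (weightedDiff e v) p) :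
    substWeights w p z ∈ boundaries (weightedDiff e fun H => aeval w (v H)) p := by
  rcases p with _ | p
  · rw [(Submodule.mem_bot _).mp hz, map_zero]
    exact Submodule.zero_mem _
  · obtain ⟨y, rfl⟩ := hz
    exact ⟨_, (substWeights_weightedDiff e v w p y).symm⟩

theorem baseChange_baseChange_anti (e : Fin n → ∀ p, M p →ₗ[R] M (p + 1))
    (he : ∀ H K p z, e H (p + 1) (e K p z) = - e K (p + 1) (e H p z)) (H K : Fin n) (p : ℕ)
    (z : MvPolynomial (Fin n) R ⊗[R] M p) :
    (e H (p + 1)).baseChange (MvPolynomial (Fin n) R) ((e K p).baseChange _ z) =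
      - (e K (p + 1)).baseChange _ ((e H p).baseChange _ z) := by
  induction z with
  | zero => simp
  | add x y hx hy => simp only [map_add, hx, hy, neg_add]
  | tmul a m => simp [he H K, TensorProduct.tmul_neg]

theorem weightedDiff_baseChange (e : Fin n → ∀ p, M p →ₗ[R] M (p + 1))
    (he : ∀ H K p z, e H (p + 1) (e K p z) = - e K (p + 1) (e H p z))
    (w : Fin n → MvPolynomial (Fin n) R) (k : Fin n) (p : ℕ)
    (z : MvPolynomial (Fin n) R ⊗[R] M p) :
    weightedDiff e w (p + 1) ((e k p).baseChange _ z) =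
      - (e k (p + 1)).baseChange _ (weightedDiff e w p z) := by
  simp only [weightedDiff_apply, map_sum, ← Finset.sum_neg_distrib, map_smul]
  refine Finset.sum_congr rfl fun H _ => ?_
  rw [baseChange_baseChange_anti e he H k, smul_neg]

theorem baseChange_baseChange_self (e : Fin n → ∀ p, M p →ₗ[R] M (p + 1))
    (he0 : ∀ H p z, e H (p + 1) (e H p z) = 0) (k : Fin n) (p : ℕ)
    (z : MvPolynomial (Fin n) R ⊗[R] M p) :
    (e k (p + 1)).baseChange (MvPolynomial (Fin n) R) ((e k p).baseChange _ z) = 0 := by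
  induction z with
  | zero => simp
  | add x y hx hy => simp only [map_add, hx, hy, add_zero]
  | tmul a m => simp [he0]

theorem weightedDiff_weightedDiff (e : Fin n → ∀ p, M p →ₗ[R] M (p + 1))
    (he : ∀ H K p z, e H (p + 1) (e K p z) = - e K (p + 1) (e H p z))
    (he0 : ∀ H p z, e H (p + 1) (e H p z) = 0)
    (w : Fin n → MvPolynomial (Fin n) R) (p : ℕ) (z : MvPolynomial (Fin n) R ⊗[R] M p) :
    weightedDiff e w (p + 1) (weightedDiff e w p z) = 0 := by
  simp only [weightedDiff_apply, map_sum, map_smul, Finset.smul_sum, smul_smul]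
  rw [← Finset.sum_product']
  refine Finset.sum_involution (fun a _ => (a.2, a.1)) ?_ ?_ (by simp) (by simp)
  · rintro ⟨H, K⟩ _
    simp [baseChange_baseChange_anti e he H K, mul_comm (w H)]
  · rintro ⟨H, K⟩ _ hne heq
    obtain rfl : K = H := congrArg Prod.fst heq
    exact hne (by simp [baseChange_baseChange_self e he0])

/-- Specializing the weights one after the other preserves the property that a power of `g` kills
the cohomology. -/
theorem exists_pow_smul_mem_boundaries_subst (e : Fin n → ∀ p, M p →ₗ[R] M (p + 1))
    (he : ∀ H K p z, e H (p + 1) (e K p z) = - e K (p + 1) (e H p z))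
    (he0 : ∀ H p z, e H (p + 1) (e H p z) = 0) (lam : Fin n → R) (g : MvPolynomial (Fin n) R)
    (hg : ∀ p, ∃ m, ∀ z, weightedDiff e X p z = 0 → g ^ m • z ∈ boundaries (weightedDiff e X) p)
    (K : Finset (Fin n)) (p : ℕ) :
    ∃ m, ∀ z, weightedDiff e (fun H => if H ∈ K then C (lam H) else X H) p z = 0 →
      substWeights (fun H => if H ∈ K then C (lam H) else X H) p z = z →
      aeval (fun H => if H ∈ K then C (lam H) else X H) g ^ m • z ∈
        boundaries (weightedDiff e fun H => if H ∈ K then C (lam H) else X H) p := by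
  -- All partial specializations live on the same modules `S ⊗ M`. The condition `substWeights z =
  -- z` says that `z` does not involve the weights already specialized.
  induction K using Finset.induction_on generalizing p with
  | empty =>
    obtain ⟨m, hm⟩ := hg p
    refine ⟨m, fun z hz _ => ?_⟩
    have hX : (fun H : Fin n => if H ∈ (∅ : Finset (Fin n)) then C (lam H) else X H) = X := by
      funext H; simp
    rw [hX] at hz ⊢
    rw [aeval_X_left, AlgHom.id_apply]
    exact hm z hz
  | insert k K hk ih =>
    set w : Fin n → MvPolynomial (Fin n) R := fun H => if H ∈ K then C (lam H) else X H with hw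
    set w' : Fin n → MvPolynomial (Fin n) R :=
      fun H => if H ∈ insert k K then C (lam H) else X H with hw'
    have hw'w : (fun H => aeval w' (w H)) = w' := by
      funext H
      by_cases h : H ∈ K <;> simp [hw, hw', h]
    have hww' : (fun H => aeval w (w' H)) = w' := by
      funext H
      by_cases h : H = k <;> by_cases h' : H ∈ K <;> simp [hw, hw', h, h']
    have hww : (fun H => aeval w (w H)) = w := by
      funext H
      by_cases h : H ∈ K <;> simp [hw, h]
    have hgw : aeval w (aeval w g) = aeval w g := by
      rw [comp_aeval_apply, hww]
    have hgw' : aeval w' (aeval w g) = aeval w' g := by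
      rw [comp_aeval_apply, hw'w]
    have hwk : w k = X k := by simp [hw, hk]
    obtain ⟨m₁, hm₁⟩ := ih (p + 1)
    obtain ⟨m₂, hm₂⟩ := ih p
    refine ⟨m₂ + m₁, fun z hz hσ => ?_⟩
    have hσw : substWeights w p z = z := by
      rw [← hσ, substWeights_substWeights, hww']
    set t : MvPolynomial (Fin n) R := X k - C (lam k) with ht
    -- The weights `w` and `w'` differ only at `k`, and `z` is a cocycle for `w'`. Since `e_k² = 0`,
    -- it follows that `e_k z` is a cocycle for `w`, without any cancellation of `t`.
    have hdz : weightedDiff e w p z = t • (e k p).baseChange _ z := by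
      rw [← sub_zero (weightedDiff e w p z), ← hz, weightedDiff_apply, weightedDiff_apply,
        ← Finset.sum_sub_distrib, Finset.sum_eq_single k]
      · rw [show t = w k - w' k by simp [hwk, hw', ht]]
        exact (sub_smul _ _ _).symm
      · intro H _ hH
        simp [hw, hw', hH]
      · simp
    have hd1 : weightedDiff e w (p + 1) ((e k p).baseChange _ z) = 0 := by
      rw [weightedDiff_baseChange e he, hdz, map_smul, baseChange_baseChange_self e he0]
      simp
    obtain ⟨u, hu⟩ := hm₁ _ hd1 (by rw [substWeights_baseChange, hσw])
    have hu' : weightedDiff e w p (substWeights w p u) =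
        aeval w g ^ m₁ • (e k p).baseChange _ z := by
      have := congrArg (substWeights w (p + 1)) hu
      rwa [substWeights_weightedDiff, substWeights_smul, hww, map_pow, hgw,
        substWeights_baseChange, hσw] at this
    -- Correcting `g^m₁ z` by `t u` makes it a cocycle for `w`, to which induction in degree `p`
    -- applies. Setting `X k = λ_k` afterwards removes the correction because `t` becomes 0.
    have hy := hm₂ (aeval w g ^ m₁ • z - t • substWeights w p u)
      (by rw [map_sub, map_smul, map_smul, hu', hdz, smul_comm, sub_self])
      (by
        rw [map_sub, substWeights_smul, substWeights_smul, substWeights_substWeights, hww, hσw,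
          map_pow, hgw]
        simp [ht, hwk])
    have := substWeights_mem_boundaries e w w' p _ hy
    rw [hw'w, substWeights_smul, map_sub, substWeights_smul, substWeights_smul, hσ, map_pow,
      map_pow, hgw', show aeval w' t = 0 by simp [ht, hw'], zero_smul, sub_zero, smul_smul,
      ← pow_add] at this
    exact this

/-- If a power of `g` kills the cohomology for generic weights, then a power of `g(λ)` kills the
cohomology for the weights `λ`. -/
theorem exists_pow_aeval_smul_mem_boundaries (e : Fin n → ∀ p, M p →ₗ[R] M (p + 1))
    (he : ∀ H K p z, e H (p + 1) (e K p z) = - e K (p + 1) (e H p z))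
    (he0 : ∀ H p z, e H (p + 1) (e H p z) = 0) (lam : Fin n → R) (g : MvPolynomial (Fin n) R)
    (hg : ∀ p, ∃ m, ∀ z, weightedDiff e X p z = 0 → g ^ m • z ∈ boundaries (weightedDiff e X) p)
    (d : ∀ p, M p →ₗ[R] M (p + 1)) (hd : ∀ p z, d p z = ∑ H, lam H • e H p z) (p : ℕ) :
    ∃ m, ∀ z, d p z = 0 → aeval lam g ^ m • z ∈ boundaries d p := by
  obtain ⟨m, hm⟩ := exists_pow_smul_mem_boundaries_subst e he he0 lam g hg Finset.univ p
  simp only [Finset.mem_univ, if_true] at hm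
  let ev : ∀ q, (MvPolynomial (Fin n) R ⊗[R] M q) →ₗ[R] M q := fun q =>
    TensorProduct.lift ((LinearMap.lsmul R (M q)).comp (aeval lam).toLinearMap)
  have ev_smul : ∀ (q : ℕ) (s : MvPolynomial (Fin n) R) (y : MvPolynomial (Fin n) R ⊗[R] M q),
      ev q (s • y) = aeval lam s • ev q y := by
    intro q s y
    induction y with
    | zero => simp
    | add x y hx hy => simp only [smul_add, map_add, hx, hy]
    | tmul a m => simp [ev, TensorProduct.smul_tmul', mul_smul]
  have ev_e : ∀ q H y, ev (q + 1) ((e H q).baseChange _ y) = e H q (ev q y) := by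
    intro q H y
    induction y with
    | zero => simp
    | add x y hx hy => simp only [map_add, hx, hy]
    | tmul a m => simp [ev]
  have ev_d : ∀ q y, ev (q + 1) (weightedDiff e (fun H => C (lam H)) q y) = d q (ev q y) := by
    intro q y
    simp [weightedDiff_apply, ev_smul, ev_e, hd]
  refine ⟨m, fun z hz => ?_⟩
  -- With all weights constant, `z` enters as `1 ⊗ z`, and evaluation at `λ` maps the resulting
  -- primitive back to `M`.
  have hz1 : weightedDiff e (fun H => C (lam H)) p ((1 : MvPolynomial (Fin n) R) ⊗ₜ[R] z) = 0 := by
    rw [weightedDiff_apply]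
    have : ∀ H, (C (lam H) : MvPolynomial (Fin n) R) •
        (e H p).baseChange (MvPolynomial (Fin n) R) (1 ⊗ₜ z) = 1 ⊗ₜ (lam H • e H p z) := by
      intro H
      rw [LinearMap.baseChange_tmul, TensorProduct.smul_tmul', smul_eq_mul, mul_one,
        TensorProduct.tmul_smul, TensorProduct.smul_tmul', smul_eq_C_mul, mul_one]
    simp only [this]
    rw [← TensorProduct.tmul_sum, ← hd, hz, TensorProduct.tmul_zero]
  have h := hm _ hz1 (by simp [substWeights])
  have hev : ev p (aeval (fun H => (C (lam H) : MvPolynomial (Fin n) R)) g ^ m •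
      ((1 : MvPolynomial (Fin n) R) ⊗ₜ[R] z)) =
      aeval lam g ^ m • z := by
    rw [ev_smul, map_pow, comp_aeval_apply]
    simp [ev]
  rw [← hev]
  rcases p with _ | p
  · rw [(Submodule.mem_bot _).mp h, map_zero]
    exact Submodule.zero_mem _
  · obtain ⟨y, hy⟩ := h
    exact ⟨ev p y, by rw [← ev_d, hy]⟩

/-- A contraction satisfying Cartan's formula is a homotopy on the complex with generic weights. -/
theorem contraction_smul_mem_boundaries (e : Fin n → ∀ p, M p →ₗ[R] M (p + 1))
    (i : ∀ p, M (p + 1) →ₗ[R] M p) (c : Fin n → R)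
    (hi0 : ∀ H z, i 0 (e H 0 z) = c H • z)
    (hi : ∀ H p z, i (p + 1) (e H (p + 1) z) = c H • z - e H p (i p z)) (p : ℕ)
    (z : MvPolynomial (Fin n) R ⊗[R] M p) (hz : weightedDiff e X p z = 0) :
    (∑ H, C (c H) * X H) • z ∈ boundaries (weightedDiff e X) p := by
  have key := congrArg ((i p).baseChange (MvPolynomial (Fin n) R)) hz
  rw [weightedDiff_apply, map_sum, map_zero] at key
  simp only [map_smul] at key
  rcases p with _ | p
  · have : ∀ H, (i 0).baseChange (MvPolynomial (Fin n) R) ((e H 0).baseChange _ z) =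
        (C (c H) : MvPolynomial (Fin n) R) • z := by
      intro H
      clear hz key
      induction z with
      | zero => simp
      | add x y hx hy => simp only [map_add, hx, hy, smul_add]
      | tmul a m =>
        simp only [LinearMap.baseChange_tmul, hi0]
        rw [TensorProduct.tmul_smul, TensorProduct.smul_tmul', TensorProduct.smul_tmul',
          smul_eq_C_mul, smul_eq_mul]
    simp only [this, smul_smul] at key
    rw [← Finset.sum_smul] at key
    simp only [mul_comm (C _)]
    rw [key]
    exact Submodule.zero_mem _
  · have : ∀ H, (i (p + 1)).baseChange (MvPolynomial (Fin n) R) ((e H (p + 1)).baseChange _ z) =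
        (C (c H) : MvPolynomial (Fin n) R) • z - (e H p).baseChange _ ((i p).baseChange _ z) := by
      intro H
      clear hz key
      induction z with
      | zero => simp
      | add x y hx hy => simp only [map_add, hx, hy, smul_add]; abel
      | tmul a m =>
        simp only [LinearMap.baseChange_tmul, hi]
        rw [TensorProduct.tmul_sub, TensorProduct.tmul_smul, TensorProduct.smul_tmul',
          TensorProduct.smul_tmul', smul_eq_C_mul, smul_eq_mul]
    simp only [this, smul_sub, smul_smul, Finset.sum_sub_distrib] at key
    rw [← Finset.sum_smul, ← weightedDiff_apply, sub_eq_zero] at key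
    simp only [mul_comm (C _)]
    exact ⟨_, key.symm⟩

end Specialization

/-! ### Associated primes and support of the cohomology. -/

section Support

open CategoryTheory RingTheory.Sequence

variable {S : Type u} [CommRing S] {N : ℕ → Type u} [∀ p, AddCommGroup (N p)]
  [∀ p, Module S (N p)]

/-- The cohomology in degree `p` of a complex, inside the cokernel of the incoming differential. -/
def cohomologyModule (d : ∀ p, N p →ₗ[S] N (p + 1)) (p : ℕ) :
    Submodule S (N p ⧸ boundaries d p) :=
  (LinearMap.ker (d p)).map (boundaries d p).mkQ

theorem mem_annihilator_cohomologyModule (d : ∀ p, N p →ₗ[S] N (p + 1)) (p : ℕ) (r : S) :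
    r ∈ Module.annihilator S (cohomologyModule d p) ↔
      ∀ z, d p z = 0 → r • z ∈ boundaries d p := by
  rw [Module.mem_annihilator]
  constructor
  · intro h z hz
    have := congrArg Subtype.val (h ⟨_, Submodule.mem_map_of_mem (LinearMap.mem_ker.mpr hz)⟩)
    rw [← Submodule.Quotient.mk_eq_zero, Submodule.Quotient.mk_smul]
    exact this
  · rintro h ⟨_, z, hz, rfl⟩
    refine Subtype.ext ?_
    change r • (boundaries d p).mkQ z = 0
    rw [← map_smul]
    exact (Submodule.Quotient.mk_eq_zero _).mpr (h z hz)

/-- Associated primes of the first nonvanishing cohomology module contain no long weakly regular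
sequence. -/
theorem not_isAssociatedPrime_cohomologyModule [IsNoetherianRing S]
    (d : ∀ p, N p →ₗ[S] N (p + 1)) (hd : ∀ p z, d (p + 1) (d p z) = 0)
    (hN : ∀ p, HasProjectiveDimensionLE (ModuleCat.of S (N p)) p) (p : ℕ)
    (hex : ∀ j < p, ∀ z, d j z = 0 → z ∈ boundaries d j) (Q : Ideal S) (c : ℕ) (hc : p < c)
    (hQ : ContainsWeaklyRegular Q c) : ¬ IsAssociatedPrime Q (cohomologyModule d p) := by
  intro hass
  obtain ⟨hprime, ⟨_, z, hz, rfl⟩, hx⟩ := isAssociatedPrime_iff.mp hass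
  obtain ⟨rs, hlen, hrs, reg⟩ := hQ
  have hmem := mem_boundaries_of_smul_mem d hd hN p hex Q rs (hlen ▸ hc) hrs reg z (by
    intro q hq
    rw [hx, Submodule.mem_colon_singleton, Submodule.mem_bot] at hq
    have := congrArg Subtype.val hq
    rw [← Submodule.Quotient.mk_eq_zero, Submodule.Quotient.mk_smul]
    exact this)
  apply hprime.ne_top
  rw [hx, Ideal.eq_top_iff_one, Submodule.mem_colon_singleton, one_smul, Submodule.mem_bot]
  exact Subtype.ext ((Submodule.Quotient.mk_eq_zero _).mpr hmem)

/-- A bounded complex of length `l`, with modules of projective dimension bounded by the degree,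
whose cohomology is killed by an ideal `I` of grade at least `l`, is exact except in degree `l`,
and the support of its cohomology has no component of grade exceeding `l`. -/
theorem exists_pow_smul_mem_boundaries [IsNoetherianRing S] [∀ p, Module.Finite S (N p)]
    (d : ∀ p, N p →ₗ[S] N (p + 1)) (hd : ∀ p z, d (p + 1) (d p z) = 0)
    (hN : ∀ p, HasProjectiveDimensionLE (ModuleCat.of S (N p)) p) (l : ℕ)
    (hl : ∀ p, l < p → Subsingleton (N p)) (I : Ideal S)
    (hI : ∀ τ ∈ I, ∀ p z, d p z = 0 → τ • z ∈ boundaries d p) (g : S)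
    (hQ : ∀ Q : Ideal S, Q.IsPrime → I ≤ Q → ContainsWeaklyRegular Q l)
    (hQg : ∀ Q : Ideal S, Q.IsPrime → I ≤ Q → g ∉ Q → ContainsWeaklyRegular Q (l + 1)) (p : ℕ) :
    ∃ m, ∀ z, d p z = 0 → g ^ m • z ∈ boundaries d p := by
  have hann : ∀ p, I ≤ Module.annihilator S (cohomologyModule d p) := fun p τ hτ =>
    (mem_annihilator_cohomologyModule d p τ).mpr (hI τ hτ p)
  have hle : ∀ p Q, IsAssociatedPrime Q (cohomologyModule d p) → I ≤ Q := fun p Q h =>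
    (hann p).trans (by
      have := h.annihilator_le
      rwa [Submodule.annihilator_top] at this)
  have hex : ∀ p < l, ∀ z, d p z = 0 → z ∈ boundaries d p := by
    intro p
    induction p using Nat.strong_induction_on with
    | _ p ih =>
      intro hp z hz
      have : Subsingleton (cohomologyModule d p) := by
        by_contra hns
        rw [not_subsingleton_iff_nontrivial] at hns
        obtain ⟨Q, hass⟩ := associatedPrimes.nonempty S (cohomologyModule d p)
        exact not_isAssociatedPrime_cohomologyModule d hd hN p
          (fun j hj => ih j hj (hj.trans hp)) Q l hp (hQ Q hass.isPrime (hle p Q hass)) hass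
      have := (mem_annihilator_cohomologyModule d p 1).mp
        (Module.mem_annihilator.mpr fun m => Subsingleton.elim _ _) z hz
      rwa [one_smul] at this
  rcases lt_trichotomy p l with hp | rfl | hp
  · exact ⟨0, fun z hz => by simpa using hex p hp z hz⟩
  -- A minimal prime of the annihilator is associated. If it missed `g`, it would contain a regular
  -- sequence one longer than the degree, which the acyclicity lemma excludes.
  · have hrad : g ∈ (Module.annihilator S (cohomologyModule d p)).radical := by
      rw [← Ideal.sInf_minimalPrimes, Ideal.mem_sInf]
      intro Q hmin
      by_contra hg
      have hass := Module.associatedPrimes.minimalPrimes_annihilator_subset_associatedPrimes S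
        (cohomologyModule d p) hmin
      exact not_isAssociatedPrime_cohomologyModule d hd hN p hex Q (p + 1) (Nat.lt_succ_self p)
        (hQg Q hass.isPrime (hle p Q hass) hg) hass
    obtain ⟨m, hm⟩ := hrad
    exact ⟨m, (mem_annihilator_cohomologyModule d p _).mp hm⟩
  · have := hl p hp
    exact ⟨0, fun z _ => by rw [Subsingleton.elim z 0, smul_zero]; exact Submodule.zero_mem _⟩

/-- If the cohomology of a complex, with modules of projective dimension bounded by the degree, is
killed by powers of the elements of an ideal whose overprimes have grade more than `p`, then it
vanishes up to degree `p`. -/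
theorem mem_boundaries_of_le_radical [IsNoetherianRing S]
    (d : ∀ p, N p →ₗ[S] N (p + 1)) (hd : ∀ p z, d (p + 1) (d p z) = 0)
    (hN : ∀ p, HasProjectiveDimensionLE (ModuleCat.of S (N p)) p) (J : Ideal S)
    (hJ : ∀ p, J ≤ (Module.annihilator S (cohomologyModule d p)).radical) (p c : ℕ) (hpc : p < c)
    (hQ : ∀ Q : Ideal S, Q.IsPrime → J ≤ Q → ContainsWeaklyRegular Q c) (z : N p)
    (hz : d p z = 0) : z ∈ boundaries d p := by
  induction p using Nat.strong_induction_on with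
  | _ p ih =>
    have : Subsingleton (cohomologyModule d p) := by
      by_contra hns
      rw [not_subsingleton_iff_nontrivial] at hns
      obtain ⟨Q, hass⟩ := associatedPrimes.nonempty S (cohomologyModule d p)
      have hJQ : J ≤ Q := (hJ p).trans (hass.isPrime.radical_le_iff.mpr (by
        have := IsAssociatedPrime.annihilator_le hass
        rwa [Submodule.annihilator_top] at this))
      exact not_isAssociatedPrime_cohomologyModule d hd hN p
        (fun j hj z hz => ih j hj (hj.trans hpc) z hz) Q c hpc (hQ Q hass.isPrime hJQ) hass
    have := (mem_annihilator_cohomologyModule d p 1).mp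
      (Module.mem_annihilator.mpr fun m => Subsingleton.elim _ _) z hz
    rwa [one_smul] at this

end Support

/-! ### The dimension of the zero locus of `logIdeal`. -/

namespace CentralArrangement

open MvPolynomial

variable {l n : ℕ} (A : CentralArrangement l n)

/-- The linear form with given coefficients, as a polynomial. -/
noncomputable def linPoly (l : ℕ) : (Fin l → ℂ) →ₗ[ℂ] CoordRing l :=
  Fintype.linearCombination ℂ fun i => (X i : CoordRing l)

theorem linPoly_coeff (H : Fin n) : linPoly l (A.coeff H) = A.linForm H := by
  simp [linPoly, linForm, Fintype.linearCombination_apply, smul_eq_C_mul]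

theorem linPoly_single (i : Fin l) : linPoly l (Pi.single i 1) = X i := by
  simp [linPoly]

/-- `T`, the restriction to linear forms of a derivation of `R`, is a logarithmic derivation with
`T(α_H) = c_H α_H`. -/
def IsLogDerivation (T : (Fin l → ℂ) →ₗ[ℂ] CoordRing l) (c : Fin n → CoordRing l) : Prop :=
  ∀ H, T (A.coeff H) = c H * A.linForm H

/-- The ideal generated by the values of the logarithmic derivations on the form `∑ a_H dα_H/α_H`
with generic weights. -/
noncomputable def logIdeal : Ideal (MvPolynomial (Fin n) (CoordRing l)) :=
  Ideal.span {τ | ∃ T c, A.IsLogDerivation T c ∧ τ = ∑ H, C (c H) * X H}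

theorem sum_mem_logIdeal {T : (Fin l → ℂ) →ₗ[ℂ] CoordRing l} {c : Fin n → CoordRing l}
    (h : A.IsLogDerivation T c) : ∑ H, C (c H) * X H ∈ A.logIdeal :=
  Ideal.subset_span ⟨T, c, h, rfl⟩

section Field

variable {F : Type} [Field F] [Algebra ℂ F]
  (φ : MvPolynomial (Fin n) (CoordRing l) →ₐ[ℂ] F)

/-- The product of the defining forms with nonzero image under `φ`. -/
noncomputable def unitPart : CoordRing l :=
  open Classical in ∏ H with φ (C (A.linForm H)) ≠ 0, A.linForm H

theorem map_unitPart_ne_zero : φ (C (A.unitPart φ)) ≠ 0 := by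
  classical
  rw [unitPart, map_prod, map_prod, Finset.prod_ne_zero_iff]
  intro H hH
  exact (Finset.mem_filter.mp hH).2

theorem exists_unitPart_eq_mul (H : Fin n) (hH : φ (C (A.linForm H)) ≠ 0) :
    ∃ d, A.unitPart φ = d * A.linForm H := by
  classical
  obtain ⟨d, hd⟩ := Finset.dvd_prod_of_mem A.linForm
    (Finset.mem_filter.mpr ⟨Finset.mem_univ H, hH⟩ : H ∈ Finset.univ.filter
      fun H => φ (C (A.linForm H)) ≠ 0)
  exact ⟨d, by rw [unitPart, hd, mul_comm]⟩

/-- The span of the coefficient vectors of the defining forms killed by `φ`. -/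
def killedSpan : Submodule ℂ (Fin l → ℂ) :=
  Submodule.span ℂ (A.coeff '' {H | φ (C (A.linForm H)) = 0})

theorem map_linPoly_eq_zero {c : Fin l → ℂ} (hc : c ∈ A.killedSpan φ) :
    φ (C (linPoly l c)) = 0 := by
  have : A.killedSpan φ ≤ LinearMap.ker (φ.toLinearMap ∘ₗ
      (Algebra.linearMap (CoordRing l) (MvPolynomial (Fin n) (CoordRing l))).restrictScalars ℂ ∘ₗ
      linPoly l) := by
    refine Submodule.span_le.mpr ?_
    rintro _ ⟨H, hH, rfl⟩
    change φ (C (linPoly l (A.coeff H))) = 0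
    rw [linPoly_coeff]
    exact hH
  exact this hc

variable (hφ : ∀ τ ∈ A.logIdeal, φ τ = 0)

include hφ in
-- Take the constant vector field `ψ` times the product of the forms not killed by `φ`. It is
-- logarithmic: the killed forms are constant along `ψ`, and the product is divisible by each of the
-- others. Its pairing with the generic form, divided by the product, is the sum.
theorem sum_div_eq_zero (ψ : (Fin l → ℂ) →ₗ[ℂ] ℂ) (hψ : ∀ c ∈ A.killedSpan φ, ψ c = 0) :
    ∑ H, algebraMap ℂ F (ψ (A.coeff H)) * (φ (X H) / φ (C (A.linForm H))) = 0 := by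
  classical
  choose! d hd using A.exists_unitPart_eq_mul φ
  let c : Fin n → CoordRing l := fun H =>
    if φ (C (A.linForm H)) = 0 then 0 else C (ψ (A.coeff H)) * d H
  have hT : A.IsLogDerivation (LinearMap.toSpanSingleton ℂ _ (A.unitPart φ) ∘ₗ ψ) c := by
    intro H
    by_cases h : φ (C (A.linForm H)) = 0
    · simp [c, h, hψ _ (Submodule.subset_span ⟨H, h, rfl⟩)]
    · simp only [LinearMap.comp_apply, LinearMap.toSpanSingleton_apply, c, h, if_false]
      rw [smul_eq_C_mul, mul_assoc, ← hd H h]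
  have h := hφ _ (A.sum_mem_logIdeal hT)
  have hu := A.map_unitPart_ne_zero φ
  refine ((mul_eq_zero (a := φ (C (A.unitPart φ)))).mp ?_).resolve_left hu
  refine Eq.trans ?_ h
  rw [map_sum, Finset.mul_sum]
  refine Finset.sum_congr rfl fun H _ => ?_
  by_cases hH : φ (C (A.linForm H)) = 0
  · simp [c, hH]
  · have hC : φ (C (C (ψ (A.coeff H)))) = algebraMap ℂ F (ψ (A.coeff H)) :=
      φ.commutes (ψ (A.coeff H))
    simp only [c, hH, if_false, map_mul, hC]
    nth_rw 1 [hd H hH]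
    rw [map_mul, map_mul]
    field_simp

include hφ in
-- This is the Euler field of the subarrangement of killed forms: project `V*` onto their span and
-- multiply by `unitPart`. On a killed form the coefficient is `unitPart` itself; on any other it is
-- divisible by a form in the killed span, so `φ` sends it to 0.
theorem sum_killed_eq_zero :
    ∑ H, (open Classical in if φ (C (A.linForm H)) = 0 then φ (X H) else 0) = 0 := by
  classical
  choose! d hd using A.exists_unitPart_eq_mul φ
  obtain ⟨P, hP⟩ := (A.killedSpan φ).subtype.exists_leftInverse_of_injective
    (LinearMap.ker_eq_bot.mpr (A.killedSpan φ).injective_subtype)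
  let c : Fin n → CoordRing l := fun H =>
    if φ (C (A.linForm H)) = 0 then A.unitPart φ else d H * linPoly l (P (A.coeff H))
  have hT : A.IsLogDerivation (LinearMap.mulLeft ℂ (A.unitPart φ) ∘ₗ linPoly l ∘ₗ
      (A.killedSpan φ).subtype ∘ₗ P) c := by
    intro H
    by_cases h : φ (C (A.linForm H)) = 0
    · have hmem : A.coeff H ∈ A.killedSpan φ := Submodule.subset_span ⟨H, h, rfl⟩
      have hPH : P (A.coeff H) = ⟨A.coeff H, hmem⟩ := LinearMap.congr_fun hP ⟨A.coeff H, hmem⟩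
      simp [c, h, hPH, linPoly_coeff]
    · simp only [LinearMap.comp_apply, LinearMap.mulLeft_apply, c, h, if_false,
        Submodule.subtype_apply]
      rw [hd H h]
      ring
  have h := hφ _ (A.sum_mem_logIdeal hT)
  have hu := A.map_unitPart_ne_zero φ
  refine ((mul_eq_zero (a := φ (C (A.unitPart φ)))).mp ?_).resolve_left hu
  refine Eq.trans ?_ h
  rw [map_sum, Finset.mul_sum]
  refine Finset.sum_congr rfl fun H _ => ?_
  by_cases hH : φ (C (A.linForm H)) = 0
  · simp [c, hH]
  · simp [c, hH, A.map_linPoly_eq_zero φ (P (A.coeff H)).2]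

include hφ in
/-- The field generated by the images of the coordinates and the weights has few generators. -/
theorem exists_generators (hess : A.IsEssential)
    (hgen : ∀ L : IntermediateField ℂ F, (∀ s, φ s ∈ L) → L = ⊤) :
    ∃ y : Fin n → F, ∀ E : Set (Fin n),
      (∀ H ∉ E, φ (C (A.linForm H)) = 0 ∧ ∀ H' ∉ E, H' = H) →
      IntermediateField.adjoin ℂ (y '' E) = ⊤ := by
  classical
  set W := A.killedSpan φ with hW
  -- The forms indexed by `a` induce a basis of `V*/W`, where `W` is the killed span.
  obtain ⟨κ, a, ha, hspan, hli⟩ := exists_linearIndependent' ℂ (fun H => W.mkQ (A.coeff H))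
  have hspan' : Submodule.span ℂ (Set.range ((fun H => W.mkQ (A.coeff H)) ∘ a)) = ⊤ := by
    rw [hspan, Set.range_comp' W.mkQ A.coeff, Submodule.span_image, hess, Submodule.map_top,
      Submodule.range_mkQ]
  let b := Module.Basis.mk hli hspan'.ge
  have : Finite κ := Finite.of_injective a ha
  have := Fintype.ofFinite κ
  have hb : ∀ k, b k = W.mkQ (A.coeff (a k)) := fun k => Module.Basis.mk_apply ..
  have ha0 : ∀ k, φ (C (A.linForm (a k))) ≠ 0 := by
    intro k hk
    apply b.ne_zero k
    rw [hb]
    exact (Submodule.Quotient.mk_eq_zero _).mpr (Submodule.subset_span ⟨a k, hk, rfl⟩)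
  -- There is one generator per hyperplane: the form itself for the basis, the weight otherwise. The
  -- weights of the basis hyperplanes are recovered from `sum_div_eq_zero` with the dual basis. If
  -- `E` omits a killed hyperplane, its weight is recovered from `sum_killed_eq_zero`.
  let y : Fin n → F := fun H => if H ∈ Set.range a then φ (C (A.linForm H)) else φ (X H)
  refine ⟨y, fun E hE => hgen _ ?_⟩
  set L := IntermediateField.adjoin ℂ (y '' E)
  have hyL : ∀ H ∈ E, y H ∈ L := fun H hH =>
    IntermediateField.subset_adjoin _ _ ⟨H, hH, rfl⟩
  have haE : ∀ k, a k ∈ E := fun k => by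
    by_contra h
    exact ha0 k (hE _ h).1
  have hlinPoly_a : ∀ k, φ (C (A.linForm (a k))) ∈ L := fun k => by
    have := hyL _ (haE k)
    rwa [show y (a k) = φ (C (A.linForm (a k))) by simp [y]] at this
  have hlin : ∀ v, φ (C (linPoly l v)) ∈ L := by
    intro v
    have hv : v - ∑ k, b.repr (W.mkQ v) k • A.coeff (a k) ∈ W := by
      refine (Submodule.Quotient.mk_eq_zero W).mp ?_
      rw [← Submodule.mkQ_apply, map_sub, map_sum, sub_eq_zero]
      conv_lhs => rw [← b.sum_repr (W.mkQ v)]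
      refine Finset.sum_congr rfl fun k _ => ?_
      rw [map_smul, hb]
    have h0 := A.map_linPoly_eq_zero φ hv
    rw [map_sub, map_sub, map_sub, sub_eq_zero] at h0
    rw [h0]
    simp only [map_sum, map_smul, linPoly_coeff]
    refine sum_mem fun k _ => ?_
    rw [smul_eq_C_mul, map_mul, map_mul]
    refine mul_mem ?_ (hlinPoly_a k)
    have : φ (C (C (b.repr (W.mkQ v) k))) = algebraMap ℂ F (b.repr (W.mkQ v) k) :=
      φ.commutes _
    rw [this]
    exact L.algebraMap_mem _
  have hform : ∀ H, φ (C (A.linForm H)) ∈ L := fun H => A.linPoly_coeff H ▸ hlin _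
  have hX1 : ∀ H ∈ E, H ∉ Set.range a → φ (X H) ∈ L := by
    intro H hH hHa
    have := hyL _ hH
    rwa [show y H = φ (X H) from if_neg hHa] at this
  have hX2 : ∀ k, φ (X (a k)) ∈ L := by
    intro k
    have h := A.sum_div_eq_zero φ hφ (b.coord k ∘ₗ W.mkQ) (fun c hc => by
      rw [LinearMap.comp_apply, Submodule.mkQ_apply, (Submodule.Quotient.mk_eq_zero _).mpr hc,
        map_zero])
    rw [← Finset.add_sum_erase _ _ (Finset.mem_univ (a k))] at h
    have h1 : (b.coord k ∘ₗ W.mkQ) (A.coeff (a k)) = 1 := by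
      rw [LinearMap.comp_apply, ← hb]; simp
    rw [h1, map_one, one_mul, add_eq_zero_iff_eq_neg, div_eq_iff (ha0 k)] at h
    rw [h]
    refine mul_mem (neg_mem (sum_mem fun H hH => ?_)) (hform _)
    by_cases hHa : H ∈ Set.range a
    · obtain ⟨k', rfl⟩ := hHa
      have hne : k' ≠ k := fun h => (Finset.mem_erase.mp hH).1 (h ▸ rfl)
      have : (b.coord k ∘ₗ W.mkQ) (A.coeff (a k')) = 0 := by
        rw [LinearMap.comp_apply, ← hb]; simp [hne]
      rw [this, map_zero, zero_mul]
      exact zero_mem _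
    · by_cases hHE : H ∈ E
      · exact mul_mem (L.algebraMap_mem _) (div_mem (hX1 H hHE hHa) (hform H))
      · rw [(hE H hHE).1, div_zero, mul_zero]
        exact zero_mem _
  have hX : ∀ H, φ (X H) ∈ L := by
    intro H
    by_cases hHa : H ∈ Set.range a
    · obtain ⟨k, rfl⟩ := hHa
      exact hX2 k
    by_cases hHE : H ∈ E
    · exact hX1 H hHE hHa
    · have h := A.sum_killed_eq_zero φ hφ
      rw [← Finset.add_sum_erase _ _ (Finset.mem_univ H), if_pos (hE H hHE).1,
        add_eq_zero_iff_eq_neg] at h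
      rw [h]
      refine neg_mem (sum_mem fun H' hH' => ?_)
      split_ifs with h0
      · have hne := (Finset.mem_erase.mp hH').1
        refine hX1 H' ?_ ?_
        · by_contra h'
          exact hne ((hE H hHE).2 H' h')
        · rintro ⟨k, rfl⟩
          exact ha0 k h0
      · exact zero_mem _
  intro s
  induction s using MvPolynomial.induction_on with
  | C r =>
    induction r using MvPolynomial.induction_on with
    | C z => exact φ.commutes z ▸ L.algebraMap_mem z
    | add p q hp hq => rw [map_add, map_add]; exact add_mem hp hq
    | mul_X p i hp =>
      rw [map_mul, map_mul]
      exact mul_mem hp (linPoly_single i ▸ hlin _)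
  | add p q hp hq => rw [map_add]; exact add_mem hp hq
  | mul_X p H hp => rw [map_mul]; exact mul_mem hp (hX H)

end Field

theorem trdeg_le_of_adjoin_eq_top {k F : Type} [Field k] [Field F] [Algebra k F] (s : Set F)
    (hs : IntermediateField.adjoin k s = ⊤) : Algebra.trdeg k F ≤ Cardinal.mk s := by
  have : Algebra.IsAlgebraic (Algebra.adjoin k s) F := by
    constructor
    intro x
    obtain ⟨r, hr, t, ht, rfl⟩ := IntermediateField.mem_adjoin_iff_div.mp
      (hs ▸ IntermediateField.mem_top : x ∈ IntermediateField.adjoin k s)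
    rw [div_eq_mul_inv]
    exact (isAlgebraic_algebraMap (⟨r, hr⟩ : Algebra.adjoin k s)).mul
      (isAlgebraic_algebraMap (⟨t, ht⟩ : Algebra.adjoin k s)).inv
  exact Algebra.IsAlgebraic.trdeg_le_cardinalMk k s

/-- The set `E` is everything, or omits one hyperplane whose form lies in `Q`. The bounds `n` and `n
- 1` mean codimension at least `ℓ` and `ℓ + 1` in `V × ℂ^𝒜`. -/
theorem trdeg_quotient_le_of_logIdeal_le (hess : A.IsEssential)
    (Q : Ideal (MvPolynomial (Fin n) (CoordRing l))) [Q.IsPrime] (hQ : A.logIdeal ≤ Q)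
    (E : Set (Fin n)) (hE : ∀ H ∉ E, C (A.linForm H) ∈ Q ∧ ∀ H' ∉ E, H' = H) :
    Algebra.trdeg ℂ (MvPolynomial (Fin n) (CoordRing l) ⧸ Q) ≤ Cardinal.mk E := by
  let F := FractionRing (MvPolynomial (Fin n) (CoordRing l) ⧸ Q)
  let ι : (MvPolynomial (Fin n) (CoordRing l) ⧸ Q) →ₐ[ℂ] F :=
    (Algebra.ofId (MvPolynomial (Fin n) (CoordRing l) ⧸ Q) F).restrictScalars ℂ
  have hι : Function.Injective ι :=
    IsFractionRing.injective (MvPolynomial (Fin n) (CoordRing l) ⧸ Q) F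
  let φ := ι.comp (Ideal.Quotient.mkₐ ℂ Q)
  have hφ0 : ∀ s, s ∈ Q → φ s = 0 := fun s hs => by
    change ι (Ideal.Quotient.mk Q s) = 0
    rw [Ideal.Quotient.eq_zero_iff_mem.mpr hs, map_zero]
  obtain ⟨y, hy⟩ := A.exists_generators φ (fun τ hτ => hφ0 τ (hQ hτ)) hess (by
    intro L hL
    rw [eq_top_iff]
    intro x _
    obtain ⟨a, b, _, rfl⟩ := IsFractionRing.div_surjective
      (A := MvPolynomial (Fin n) (CoordRing l) ⧸ Q) x
    obtain ⟨a, rfl⟩ := Ideal.Quotient.mk_surjective a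
    obtain ⟨b, rfl⟩ := Ideal.Quotient.mk_surjective b
    exact div_mem (hL a) (hL b))
  exact (trdeg_le_of_injective ι hι).trans ((trdeg_le_of_adjoin_eq_top _
    (hy E fun H hH => ⟨hφ0 _ (hE H hH).1, (hE H hH).2⟩)).trans Cardinal.mk_image_le)

/-- The polynomial ring in the coordinates and the weights. -/
noncomputable def weightRingEquiv (l n : ℕ) :
    MvPolynomial (Fin l ⊕ Fin n) ℂ ≃ₐ[ℂ] MvPolynomial (Fin n) (CoordRing l) :=
  (renameEquiv ℂ (Equiv.sumComm (Fin l) (Fin n))).trans (sumAlgEquiv ℂ (Fin n) (Fin l))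

theorem weightRingEquiv_X_inl (i : Fin l) : weightRingEquiv l n (X (Sum.inl i)) = C (X i) := by
  simp [weightRingEquiv]

theorem weightRingEquiv_X_inr (H : Fin n) : weightRingEquiv l n (X (Sum.inr H)) = X H := by
  simp [weightRingEquiv]

theorem containsWeaklyRegular_of_trdeg_weightRing
    (Q : Ideal (MvPolynomial (Fin n) (CoordRing l))) (c : ℕ)
    (h : Algebra.trdeg ℂ (MvPolynomial (Fin n) (CoordRing l) ⧸ Q) + c ≤ (l + n : ℕ)) :
    ContainsWeaklyRegular Q c := by
  let e : MvPolynomial (Fin (l + n)) ℂ ≃ₐ[ℂ] MvPolynomial (Fin n) (CoordRing l) :=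
    (renameEquiv ℂ finSumFinEquiv.symm).trans (weightRingEquiv l n)
  refine ContainsWeaklyRegular.of_comap e.toRingEquiv
    (containsWeaklyRegular_of_trdeg (l + n) _ c ?_)
  have h1 := trdeg_quotient_comap_le (e : MvPolynomial (Fin (l + n)) ℂ →ₐ[ℂ] _) Q
  exact (add_le_add_left h1 _).trans h

theorem containsWeaklyRegular_of_logIdeal_le (hess : A.IsEssential)
    (Q : Ideal (MvPolynomial (Fin n) (CoordRing l))) (hprime : Q.IsPrime)
    (hQ : A.logIdeal ≤ Q) : ContainsWeaklyRegular Q l := by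
  refine containsWeaklyRegular_of_trdeg_weightRing Q l ?_
  have := A.trdeg_quotient_le_of_logIdeal_le hess Q hQ Set.univ (by simp)
  rw [Cardinal.mk_univ, Cardinal.mk_fin] at this
  rw [Nat.cast_add, add_comm]
  gcongr

theorem containsWeaklyRegular_succ_of_logIdeal_le (hess : A.IsEssential)
    (Q : Ideal (MvPolynomial (Fin n) (CoordRing l))) (hprime : Q.IsPrime)
    (hQ : A.logIdeal ≤ Q) (hf : C A.defPoly ∈ Q) : ContainsWeaklyRegular Q (l + 1) := by
  refine containsWeaklyRegular_of_trdeg_weightRing Q (l + 1) ?_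
  rw [defPoly, map_prod] at hf
  obtain ⟨H₀, -, hH₀⟩ := (hprime.prod_mem_iff).mp hf
  have := A.trdeg_quotient_le_of_logIdeal_le hess Q hQ {H₀}ᶜ (by
    intro H hH
    simp only [Set.mem_compl_iff, Set.mem_singleton_iff, not_not] at hH
    subst hH
    refine ⟨hH₀, fun H' hH' => by simpa using hH'⟩)
  have h2 : Cardinal.mk ({H₀}ᶜ : Set (Fin n)) + 1 = n := by
    have := Cardinal.mk_sum_compl ({H₀} : Set (Fin n))
    rw [Cardinal.mk_singleton, Cardinal.mk_fin] at this
    rw [add_comm, this]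
  calc _ ≤ Cardinal.mk ({H₀}ᶜ : Set (Fin n)) + ((l + 1 : ℕ) : Cardinal) := by gcongr
    _ = ((l + n : ℕ) : Cardinal) := by
      push_cast
      rw [← h2]
      ring

end CentralArrangement

/-! ### Polynomial forms and contraction. -/

section PolyForms

open MvPolynomial

variable {l : ℕ}

theorem prod_ofFn_dCoord {p : ℕ} (i : Fin p → Fin l) :
    (List.ofFn fun k => (dCoord (i k) : RatForm l)).prod =
      ExteriorAlgebra.ιMulti (RatFun l) p fun k => Pi.single (i k) 1 := by
  rw [ExteriorAlgebra.ιMulti_apply]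
  rfl

theorem polyForms_le_exteriorPower (p : ℕ) :
    polyForms l p ≤ (⋀[RatFun l]^p (Fin l → RatFun l)).restrictScalars (CoordRing l) := by
  refine Submodule.span_le.mpr ?_
  rintro _ ⟨i, rfl⟩
  simp only [prod_ofFn_dCoord]
  exact ExteriorAlgebra.ιMulti_range _ _ ⟨_, rfl⟩

/-- The coordinates of a form of degree `p`. -/
noncomputable def formCoord (p : ℕ) (s : Set.powersetCard (Fin l) p) :
    ⋀[RatFun l]^p (Fin l → RatFun l) →ₗ[RatFun l] RatFun l :=
  ((Pi.basisFun (RatFun l) (Fin l)).exteriorPower p).coord s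

/-- It reduces polynomiality of a form to its coordinates, where divisibility in `R` can be used. -/
theorem coe_mem_polyForms_iff {p : ℕ} (x : ⋀[RatFun l]^p (Fin l → RatFun l)) :
    (x : RatForm l) ∈ polyForms l p ↔
      ∀ s, formCoord p s x ∈ (algebraMap (CoordRing l) (RatFun l)).range := by
  constructor
  · let N : Submodule (CoordRing l) (⋀[RatFun l]^p (Fin l → RatFun l)) :=
      ⨅ s, (LinearMap.range (Algebra.linearMap (CoordRing l) (RatFun l))).comap
        ((formCoord p s).restrictScalars (CoordRing l))
    have hN : polyForms l p ≤ N.map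
        ((⋀[RatFun l]^p (Fin l → RatFun l)).subtype.restrictScalars (CoordRing l)) := by
      refine Submodule.span_le.mpr ?_
      rintro _ ⟨i, rfl⟩
      simp only [prod_ofFn_dCoord]
      refine ⟨exteriorPower.ιMulti (RatFun l) p fun k => Pi.single (i k) 1, ?_, rfl⟩
      simp only [N, SetLike.mem_coe, Submodule.mem_iInf, Submodule.mem_comap,
        LinearMap.restrictScalars_apply]
      intro s
      rw [formCoord, exteriorPower.basis_coord, exteriorPower.ιMultiDual_apply_ιMulti]
      refine ⟨(Matrix.of fun a c => if Set.powersetCard.ofFinEmbEquiv.symm s c = i a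
        then (1 : CoordRing l) else 0).det, ?_⟩
      rw [Algebra.linearMap_apply, RingHom.map_det]
      congr 1
      ext a c
      simp [Pi.single_apply, apply_ite]
    intro hx s
    obtain ⟨y, hy, hyx⟩ := hN hx
    obtain rfl : y = x := Subtype.ext hyx
    obtain ⟨r, hr⟩ := (Submodule.mem_iInf _).mp hy s
    exact ⟨r, hr⟩
  · intro h
    choose r hr using h
    have hx : (x : RatForm l) = ∑ s, r s •
        ((((Pi.basisFun (RatFun l) (Fin l)).exteriorPower p) s :
          ⋀[RatFun l]^p (Fin l → RatFun l)) : RatForm l) := by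
      conv_lhs => rw [← ((Pi.basisFun (RatFun l) (Fin l)).exteriorPower p).sum_repr x]
      rw [Submodule.coe_sum]
      refine Finset.sum_congr rfl fun s _ => ?_
      rw [← algebraMap_smul (RatFun l) (r s), hr]
      rfl
    rw [hx]
    refine Submodule.sum_mem _ fun s _ => Submodule.smul_mem _ _ (Submodule.subset_span ?_)
    refine ⟨Set.powersetCard.ofFinEmbEquiv.symm s, ?_⟩
    simp only [prod_ofFn_dCoord]
    rw [exteriorPower.basis_apply]
    simp [ExteriorAlgebra.ιMulti_family, Function.comp_def]

/-- A form that becomes polynomial after multiplication with each of two relatively prime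
polynomials is polynomial. -/
theorem mem_polyForms_of_smul_mem {p : ℕ} {a b : CoordRing l} (ha : a ≠ 0)
    (hab : ∀ r s : CoordRing l, a * r = b * s → a ∣ s) {x : RatForm l}
    (hax : a • x ∈ polyForms l p) (hbx : b • x ∈ polyForms l p) : x ∈ polyForms l p := by
  have ha' : algebraMap (CoordRing l) (RatFun l) a ≠ 0 := by
    simpa using ha
  have hx : x ∈ ⋀[RatFun l]^p (Fin l → RatFun l) := by
    have := polyForms_le_exteriorPower p hax
    rw [← algebraMap_smul (RatFun l) a] at this
    exact (Submodule.smul_mem_iff _ ha').mp this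
  lift x to ⋀[RatFun l]^p (Fin l → RatFun l) using hx
  rw [← algebraMap_smul (RatFun l), ← Submodule.coe_smul, coe_mem_polyForms_iff] at hax hbx
  rw [coe_mem_polyForms_iff]
  intro s
  obtain ⟨r, hr⟩ := hax s
  obtain ⟨t, ht⟩ := hbx s
  rw [map_smul, smul_eq_mul] at hr ht
  obtain ⟨q, rfl⟩ := hab t r (by
    apply IsFractionRing.injective (CoordRing l) (RatFun l)
    rw [map_mul, map_mul, hr, ht]
    ring)
  refine ⟨q, mul_left_cancel₀ ha' ?_⟩
  rw [← hr, map_mul]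

theorem polyForms_eq_bot {p : ℕ} (hp : l < p) : polyForms l p = ⊥ := by
  refine Submodule.span_eq_bot.mpr ?_
  rintro _ ⟨i, rfl⟩
  simp only [prod_ofFn_dCoord]
  refine AlternatingMap.map_eq_zero_of_not_injective _ _ fun h => ?_
  have := Fintype.card_le_of_injective i fun a b hab => h (by simp only [hab])
  simp at this
  omega

theorem polyForms_fg (p : ℕ) : (polyForms l p).FG :=
  Submodule.fg_span (Set.finite_range _)

theorem dCoord_mul_mem_polyForms {p : ℕ} (i : Fin l) {x : RatForm l} (hx : x ∈ polyForms l p) :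
    dCoord i * x ∈ polyForms l (p + 1) := by
  have : polyForms l p ≤ (polyForms l (p + 1)).comap
      (LinearMap.mulLeft (CoordRing l) (dCoord i : RatForm l)) := by
    refine Submodule.span_le.mpr ?_
    rintro _ ⟨j, rfl⟩
    refine Submodule.subset_span ⟨Fin.cons i j, ?_⟩
    simp [List.ofFn_succ]
  exact this hx

/-- The contraction of rational forms with the vector field whose values on linear forms are given
by `T`. -/
noncomputable def contraction (T : (Fin l → ℂ) →ₗ[ℂ] CoordRing l) :
    RatForm l →ₗ[RatFun l] RatForm l :=
  CliffordAlgebra.contractLeft (Fintype.linearCombination (RatFun l)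
    fun i : Fin l => algebraMap (CoordRing l) (RatFun l) (T (Pi.single i 1)))

theorem contraction_ι_mul (T : (Fin l → ℂ) →ₗ[ℂ] CoordRing l) (v : Fin l → RatFun l)
    (x : RatForm l) : contraction T (ExteriorAlgebra.ι (RatFun l) v * x) =
      (∑ i, v i * algebraMap (CoordRing l) (RatFun l) (T (Pi.single i 1))) • x -
        ExteriorAlgebra.ι (RatFun l) v * contraction T x := by
  refine (CliffordAlgebra.contractLeft_ι_mul _ v x).trans ?_
  rw [Fintype.linearCombination_apply]
  rfl

theorem contraction_dCoord_mul (T : (Fin l → ℂ) →ₗ[ℂ] CoordRing l) (i : Fin l) (x : RatForm l) :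
    contraction T (dCoord i * x) = T (Pi.single i 1) • x - dCoord i * contraction T x := by
  rw [dCoord, contraction_ι_mul]
  simp only [Pi.single_apply, ite_mul, one_mul, zero_mul, Finset.sum_ite_eq', Finset.mem_univ,
    if_true]
  rw [algebraMap_smul]

theorem contraction_one (T : (Fin l → ℂ) →ₗ[ℂ] CoordRing l) :
    contraction T (1 : RatForm l) = 0 :=
  CliffordAlgebra.contractLeft_one (Q := (0 : QuadraticForm (RatFun l) (Fin l → RatFun l))) _

theorem contraction_mem_polyForms (T : (Fin l → ℂ) →ₗ[ℂ] CoordRing l) {p : ℕ} {x : RatForm l}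
    (hx : x ∈ polyForms l (p + 1)) : contraction T x ∈ polyForms l p := by
  have key : ∀ (p : ℕ) (i : Fin (p + 1) → Fin l),
      contraction T (List.ofFn fun k => (dCoord (i k) : RatForm l)).prod ∈ polyForms l p := by
    intro p
    induction p with
    | zero =>
      intro i
      rw [List.ofFn_succ, List.prod_cons, contraction_dCoord_mul, List.ofFn_zero, List.prod_nil,
        contraction_one, mul_zero, sub_zero]
      exact Submodule.smul_mem _ _ (Submodule.subset_span ⟨Fin.elim0, by simp⟩)
    | succ p ih =>
      intro i
      rw [List.ofFn_succ, List.prod_cons, contraction_dCoord_mul]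
      exact Submodule.sub_mem _ (Submodule.smul_mem _ _ (Submodule.subset_span ⟨_, rfl⟩))
        (dCoord_mul_mem_polyForms _ (ih _))
  have : polyForms l (p + 1) ≤ (polyForms l p).comap
      ((contraction T).restrictScalars (CoordRing l)) := by
    refine Submodule.span_le.mpr ?_
    rintro _ ⟨i, rfl⟩
    exact key p i
  exact this hx

theorem contraction_eq_zero (T : (Fin l → ℂ) →ₗ[ℂ] CoordRing l) {x : RatForm l}
    (hx : x ∈ polyForms l 0) : contraction T x = 0 := by
  have : polyForms l 0 ≤ LinearMap.ker ((contraction T).restrictScalars (CoordRing l)) := by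
    refine Submodule.span_le.mpr ?_
    rintro _ ⟨i, rfl⟩
    simp only [List.ofFn_zero, List.prod_nil, SetLike.mem_coe, LinearMap.mem_ker,
      LinearMap.restrictScalars_apply]
    exact contraction_one T
  exact this hx

end PolyForms

/-! ### Logarithmic forms: multiplication by `dα_H/α_H` and contraction. -/

namespace CentralArrangement

open MvPolynomial

variable {l n : ℕ} (A : CentralArrangement l n)

section LinForm

theorem totalDegree_linForm_le (H : Fin n) : (A.linForm H).totalDegree ≤ 1 := by
  refine (totalDegree_finsetSum _ _).trans (Finset.sup_le fun i _ => ?_)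
  refine (totalDegree_mul _ _).trans ?_
  simp

theorem coeff_linForm (H : Fin n) (i : Fin l) :
    MvPolynomial.coeff (Finsupp.single i 1) (A.linForm H) = A.coeff H i := by
  classical
  simp [linForm, coeff_sum, coeff_C_mul, coeff_X, Finsupp.single_left_inj]

theorem linForm_ne_zero (H : Fin n) : A.linForm H ≠ 0 := by
  intro h
  refine A.coeff_ne_zero H (funext fun i => ?_)
  rw [← A.coeff_linForm, h, MvPolynomial.coeff_zero, Pi.zero_apply]

theorem eval_zero_linForm (H : Fin n) : eval 0 (A.linForm H) = 0 := by
  simp [linForm]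

theorem totalDegree_linForm (H : Fin n) : (A.linForm H).totalDegree = 1 := by
  refine le_antisymm (A.totalDegree_linForm_le H) (Nat.one_le_iff_ne_zero.mpr fun h => ?_)
  rw [totalDegree_eq_zero_iff_eq_C] at h
  refine A.linForm_ne_zero H ?_
  have h0 := A.eval_zero_linForm H
  rw [h, eval_C] at h0
  rw [h, h0, map_zero]

theorem prime_linForm (H : Fin n) : Prime (A.linForm H) := by
  refine (irreducible_of_totalDegree_eq_one (A.totalDegree_linForm H) fun x hx => ?_).prime
  refine isUnit_iff_ne_zero.mpr ?_
  rintro rfl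
  refine A.coeff_ne_zero H (funext fun i => ?_)
  rw [← A.coeff_linForm]
  exact zero_dvd_iff.mp (hx _)

theorem not_linForm_dvd_linForm {H K : Fin n} (hHK : H ≠ K) :
    ¬ A.linForm K ∣ A.linForm H := by
  rintro ⟨r, hr⟩
  have hr0 : r ≠ 0 := by
    rintro rfl
    exact A.linForm_ne_zero H (by rw [hr, mul_zero])
  have hdeg := totalDegree_mul_of_isDomain (A.linForm_ne_zero K) hr0
  rw [← hr, totalDegree_linForm, totalDegree_linForm] at hdeg
  obtain ⟨z, rfl⟩ : ∃ z, r = C z :=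
    ⟨_, totalDegree_eq_zero_iff_eq_C.mp (by omega : r.totalDegree = 0)⟩
  have h : ∀ i, A.coeff H i = z * A.coeff K i := by
    intro i
    rw [← coeff_linForm, hr, mul_comm, coeff_C_mul, coeff_linForm]
  have := LinearIndependent.pair_iff.mp (A.simple H K hHK) 1 (-z) (by
    ext i
    simp [h i])
  exact one_ne_zero this.1

theorem linForm_dvd_of_mul_eq_mul {H K : Fin n} (hHK : H ≠ K) (r s : CoordRing l)
    (h : A.linForm K * r = A.linForm H * s) : A.linForm K ∣ s :=
  ((A.prime_linForm K).dvd_or_dvd ⟨r, h.symm⟩).resolve_left (A.not_linForm_dvd_linForm hHK)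

theorem defPoly_ne_zero : A.defPoly ≠ 0 :=
  Finset.prod_ne_zero_iff.mpr fun H _ => A.linForm_ne_zero H

theorem algebraMap_linForm_ne_zero (H : Fin n) :
    algebraMap (CoordRing l) (RatFun l) (A.linForm H) ≠ 0 := by
  simpa using A.linForm_ne_zero H

end LinForm

section Dlog

/-- The differential `dα_H`. -/
noncomputable def dLinForm (H : Fin n) : RatForm l :=
  ∑ i, algebraMap ℂ (RatFun l) (A.coeff H i) • dCoord i

theorem dLinForm_eq_ι (H : Fin n) : A.dLinForm H =
    ExteriorAlgebra.ι (RatFun l) fun i => algebraMap ℂ (RatFun l) (A.coeff H i) := by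
  rw [pi_eq_sum_univ' (fun i => algebraMap ℂ (RatFun l) (A.coeff H i)), map_sum]
  refine Finset.sum_congr rfl fun i _ => ?_
  rw [map_smul, dCoord]

theorem dlog_eq_ι (H : Fin n) : A.dlog H = ExteriorAlgebra.ι (RatFun l)
    ((algebraMap (CoordRing l) (RatFun l) (A.linForm H))⁻¹ •
      fun i => algebraMap ℂ (RatFun l) (A.coeff H i)) := by
  rw [map_smul, ← dLinForm_eq_ι]
  rfl

theorem linForm_smul_dlog (H : Fin n) : A.linForm H • A.dlog H = A.dLinForm H := by
  rw [← algebraMap_smul (RatFun l), dlog, smul_smul,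
    mul_inv_cancel₀ (A.algebraMap_linForm_ne_zero H), one_smul]
  rfl

theorem dlog_mul_self (H : Fin n) : A.dlog H * A.dlog H = 0 := by
  rw [dlog_eq_ι, ExteriorAlgebra.ι_sq_zero]

theorem dlog_mul_dlog (H K : Fin n) : A.dlog H * A.dlog K = -(A.dlog K * A.dlog H) := by
  rw [dlog_eq_ι, dlog_eq_ι]
  exact eq_neg_of_add_eq_zero_left (ExteriorAlgebra.ι_add_mul_swap _ _)

theorem dLinForm_mul_mem_polyForms (H : Fin n) {p : ℕ} {x : RatForm l}
    (hx : x ∈ polyForms l p) : A.dLinForm H * x ∈ polyForms l (p + 1) := by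
  rw [dLinForm, Finset.sum_mul]
  refine Submodule.sum_mem _ fun i _ => ?_
  rw [smul_mul_assoc, IsScalarTower.algebraMap_apply ℂ (CoordRing l) (RatFun l), algebraMap_smul]
  exact Submodule.smul_mem _ _ (dCoord_mul_mem_polyForms i hx)

theorem contraction_dlog_mul {T : (Fin l → ℂ) →ₗ[ℂ] CoordRing l} {c : Fin n → CoordRing l}
    (hT : A.IsLogDerivation T c) (H : Fin n) (x : RatForm l) :
    contraction T (A.dlog H * x) = c H • x - A.dlog H * contraction T x := by
  rw [dlog_eq_ι, contraction_ι_mul]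
  congr 1
  rw [← algebraMap_smul (RatFun l) (c H)]
  congr 1
  have h : ∑ i, algebraMap ℂ (RatFun l) (A.coeff H i) *
      algebraMap (CoordRing l) (RatFun l) (T (Pi.single i 1)) =
      algebraMap (CoordRing l) (RatFun l) (c H * A.linForm H) := by
    rw [← hT H]
    conv_rhs => rw [pi_eq_sum_univ' (A.coeff H), map_sum, map_sum]
    refine Finset.sum_congr rfl fun i _ => ?_
    rw [map_smul, Algebra.smul_def, map_mul,
      ← IsScalarTower.algebraMap_apply ℂ (CoordRing l) (RatFun l)]
  simp only [Pi.smul_apply, smul_eq_mul, mul_assoc]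
  rw [← Finset.mul_sum, h, map_mul, mul_comm (algebraMap _ _ (c H)), ← mul_assoc,
    inv_mul_cancel₀ (A.algebraMap_linForm_ne_zero H), one_mul]

theorem isLogDerivation_linPoly : A.IsLogDerivation (linPoly l) fun _ => 1 := fun H => by
  rw [linPoly_coeff, one_mul]

theorem eulerContraction_eq : eulerContraction l = contraction (linPoly l) := by
  rw [eulerContraction, contraction]
  simp only [linPoly_single]

theorem eulerContraction_dlog_mul (H : Fin n) (x : RatForm l) :
    eulerContraction l (A.dlog H * x) = x - A.dlog H * eulerContraction l x := by
  rw [eulerContraction_eq, A.contraction_dlog_mul A.isLogDerivation_linPoly, one_smul]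

theorem eulerContraction_eulerContraction (x : RatForm l) :
    eulerContraction l (eulerContraction l x) = 0 :=
  CliffordAlgebra.contractLeft_contractLeft _ _

end Dlog

section LogForms

theorem mem_logForms {p : ℕ} {x : RatForm l} : x ∈ A.logForms p ↔
    A.defPoly • x ∈ polyForms l p ∧ ∀ H, A.defPoly • (A.dlog H * x) ∈ polyForms l (p + 1) := by
  simp [logForms, Submodule.mem_inf, Submodule.mem_iInf]

/-- For `K ≠ H`, the form `f (dα_K/α_K) ∧ (dα_H/α_H) ∧ x` becomes polynomial after multiplication by
`α_K` and also by `α_H`. These are relatively prime, so it is polynomial already. -/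
theorem dlog_mul_mem_logForms (H : Fin n) {p : ℕ} {x : RatForm l} (hx : x ∈ A.logForms p) :
    A.dlog H * x ∈ A.logForms (p + 1) := by
  rw [mem_logForms] at hx ⊢
  refine ⟨hx.2 H, fun K => ?_⟩
  by_cases hHK : H = K
  · subst hHK
    rw [← mul_assoc, dlog_mul_self, zero_mul, smul_zero]
    exact zero_mem _
  refine mem_polyForms_of_smul_mem (A.linForm_ne_zero K) (A.linForm_dvd_of_mul_eq_mul hHK) ?_ ?_
  · rw [smul_comm, ← smul_mul_assoc, linForm_smul_dlog, ← mul_smul_comm]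
    exact A.dLinForm_mul_mem_polyForms K (hx.2 H)
  · rw [← mul_assoc, dlog_mul_dlog, neg_mul, smul_neg, smul_neg, mul_assoc, smul_comm,
      ← smul_mul_assoc, linForm_smul_dlog, ← mul_smul_comm]
    exact neg_mem (A.dLinForm_mul_mem_polyForms H (hx.2 K))

/-- Cartan's formula moves the contraction past `dα_H/α_H`, leaving only the error term `c_H x`,
which has no new poles because `c_H` is a polynomial. -/
theorem contraction_mem_logForms {T : (Fin l → ℂ) →ₗ[ℂ] CoordRing l} {c : Fin n → CoordRing l}
    (hT : A.IsLogDerivation T c) {p : ℕ} {x : RatForm l} (hx : x ∈ A.logForms (p + 1)) :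
    contraction T x ∈ A.logForms p := by
  rw [mem_logForms] at hx ⊢
  refine ⟨?_, fun H => ?_⟩
  · rw [← LinearMap.map_smul_of_tower]
    exact contraction_mem_polyForms T hx.1
  · have h : A.dlog H * contraction T x = c H • x - contraction T (A.dlog H * x) := by
      rw [A.contraction_dlog_mul hT, sub_sub_cancel]
    rw [h, smul_sub, smul_comm, ← LinearMap.map_smul_of_tower]
    exact sub_mem (Submodule.smul_mem _ _ hx.1) (contraction_mem_polyForms T (hx.2 H))

theorem eq_zero_of_defPoly_smul_eq_zero {x : RatForm l} (hx : A.defPoly • x = 0) : x = 0 := by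
  rw [← algebraMap_smul (RatFun l)] at hx
  refine (smul_eq_zero.mp hx).resolve_left ?_
  simpa using A.defPoly_ne_zero

theorem contraction_eq_zero_of_mem_logForms (T : (Fin l → ℂ) →ₗ[ℂ] CoordRing l) {x : RatForm l}
    (hx : x ∈ A.logForms 0) : contraction T x = 0 := by
  refine A.eq_zero_of_defPoly_smul_eq_zero ?_
  rw [← LinearMap.map_smul_of_tower]
  exact contraction_eq_zero T (A.mem_logForms.mp hx).1

theorem logForms_eq_bot {p : ℕ} (hp : l < p) : A.logForms p = ⊥ := by
  refine (Submodule.eq_bot_iff _).mpr fun x hx => A.eq_zero_of_defPoly_smul_eq_zero ?_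
  have := (A.mem_logForms.mp hx).1
  rwa [polyForms_eq_bot hp, Submodule.mem_bot] at this

instance finite_logForms (p : ℕ) : Module.Finite (CoordRing l) (A.logForms p) := by
  have : Module.Finite (CoordRing l) (polyForms l p) := Module.Finite.of_fg (polyForms_fg p)
  let φ : A.logForms p →ₗ[CoordRing l] polyForms l p :=
    (LinearMap.lsmul (CoordRing l) (RatForm l) A.defPoly).restrict fun x hx =>
      (A.mem_logForms.mp hx).1
  refine Module.Finite.of_injective φ ((injective_iff_map_eq_zero φ).mpr fun x hx => ?_)
  exact Subtype.ext (A.eq_zero_of_defPoly_smul_eq_zero (congrArg Subtype.val hx))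

variable {A} in
theorem IsTame.hasProjectiveDimensionLE (htame : A.IsTame) (p : ℕ) :
    CategoryTheory.HasProjectiveDimensionLE (ModuleCat.of (CoordRing l) (A.logForms p)) p := by
  rcases le_or_gt p l with hp | hp
  · exact htame p hp
  · have : Subsingleton (A.logForms p) := by
      rw [logForms_eq_bot A hp]
      infer_instance
    have := ModuleCat.isZero_of_subsingleton (ModuleCat.of (CoordRing l) (A.logForms p))
    have := CategoryTheory.Limits.IsZero.hasProjectiveDimensionLT_zero this
    exact CategoryTheory.hasProjectiveDimensionLT_of_ge _ 0 _ (Nat.zero_le _)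

/-- Multiplication with `dα_H/α_H` on logarithmic forms. -/
noncomputable def dlogMul (H : Fin n) (p : ℕ) :
    A.logForms p →ₗ[CoordRing l] A.logForms (p + 1) :=
  (LinearMap.mulLeft (CoordRing l) (A.dlog H)).restrict fun _ => A.dlog_mul_mem_logForms H

/-- Contraction of logarithmic forms with a logarithmic derivation. -/
noncomputable def logContraction {T : (Fin l → ℂ) →ₗ[ℂ] CoordRing l} {c : Fin n → CoordRing l}
    (hT : A.IsLogDerivation T c) (p : ℕ) :
    A.logForms (p + 1) →ₗ[CoordRing l] A.logForms p :=
  ((contraction T).restrictScalars (CoordRing l)).restrict fun _ => A.contraction_mem_logForms hT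

theorem coe_dlogMul (H : Fin n) (p : ℕ) (x : A.logForms p) :
    (A.dlogMul H p x : RatForm l) = A.dlog H * x := rfl

theorem coe_logContraction {T : (Fin l → ℂ) →ₗ[ℂ] CoordRing l} {c : Fin n → CoordRing l}
    (hT : A.IsLogDerivation T c) (p : ℕ) (x : A.logForms (p + 1)) :
    (A.logContraction hT p x : RatForm l) = contraction T x := rfl

theorem dlogMul_dlogMul (H K : Fin n) (p : ℕ) (x : A.logForms p) :
    A.dlogMul H (p + 1) (A.dlogMul K p x) = -A.dlogMul K (p + 1) (A.dlogMul H p x) := by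
  apply Subtype.ext
  rw [Submodule.coe_neg]
  simp only [coe_dlogMul]
  rw [← mul_assoc, dlog_mul_dlog, neg_mul, mul_assoc]

theorem dlogMul_dlogMul_self (H : Fin n) (p : ℕ) (x : A.logForms p) :
    A.dlogMul H (p + 1) (A.dlogMul H p x) = 0 := by
  apply Subtype.ext
  simp only [coe_dlogMul]
  rw [← mul_assoc, dlog_mul_self, zero_mul, Submodule.coe_zero]

theorem logContraction_dlogMul_zero {T : (Fin l → ℂ) →ₗ[ℂ] CoordRing l} {c : Fin n → CoordRing l}
    (hT : A.IsLogDerivation T c) (H : Fin n) (x : A.logForms 0) :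
    A.logContraction hT 0 (A.dlogMul H 0 x) = c H • x := by
  apply Subtype.ext
  rw [coe_logContraction, coe_dlogMul, A.contraction_dlog_mul hT,
    A.contraction_eq_zero_of_mem_logForms T x.2, mul_zero, sub_zero, Submodule.coe_smul]

theorem logContraction_dlogMul {T : (Fin l → ℂ) →ₗ[ℂ] CoordRing l} {c : Fin n → CoordRing l}
    (hT : A.IsLogDerivation T c) (H : Fin n) (p : ℕ) (x : A.logForms (p + 1)) :
    A.logContraction hT (p + 1) (A.dlogMul H (p + 1) x) =
      c H • x - A.dlogMul H p (A.logContraction hT p x) := by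
  apply Subtype.ext
  rw [Submodule.coe_sub, coe_logContraction, coe_dlogMul, A.contraction_dlog_mul hT]
  rfl

end LogForms

end CentralArrangement

/-! ### The support of the generic cohomology lies in the critical variety. -/

namespace CentralArrangement

open MvPolynomial TensorProduct

variable {l n : ℕ} (A : CentralArrangement l n)

section GenericWeights

theorem weightRingEquiv_rename_inl (r : CoordRing l) :
    weightRingEquiv l n (rename Sum.inl r) = C r := by
  induction r using MvPolynomial.induction_on with
  | C a =>
    rw [rename_C]
    exact (weightRingEquiv l n).commutes a
  | add p q hp hq => rw [map_add, map_add, hp, hq, map_add]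
  | mul_X p i hp => rw [map_mul, map_mul, hp, rename_X, weightRingEquiv_X_inl, map_mul]

theorem exists_defPoly_eq_mul (H : Fin n) : ∃ d, d * A.linForm H = A.defPoly := by
  obtain ⟨d, hd⟩ := Finset.dvd_prod_of_mem A.linForm (Finset.mem_univ H)
  exact ⟨d, by rw [defPoly, hd, mul_comm]⟩

/-- Outside the arrangement, the zeros of the ideal generated by the values of logarithmic
derivations lie in the critical set. -/
theorem mem_critSet {Q : Ideal (MvPolynomial (Fin l ⊕ Fin n) ℂ)}
    (hQ : A.logIdeal ≤ Q.comap (weightRingEquiv l n).symm) {z : Fin l ⊕ Fin n → ℂ}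
    (hz : z ∈ zeroLocus ℂ Q) (hf : aeval (z ∘ Sum.inl) A.defPoly ≠ 0) : z ∈ A.critSet := by
  have hform : ∀ H, eval (z ∘ Sum.inl) (A.linForm H) ≠ 0 := fun H => by
    rw [defPoly, map_prod, Finset.prod_ne_zero_iff] at hf
    exact hf H (Finset.mem_univ H)
  refine ⟨z ∘ Sum.inl, z ∘ Sum.inr, (Sum.elim_comp_inl_inr z).symm, hform, ?_⟩
  choose d hd using A.exists_defPoly_eq_mul
  ext i
  -- The derivation `f ∂_i` is logarithmic, and its pairing with `ω_λ` is `f` times the `i`-th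
  -- coordinate of `ω_λ`.
  have hT : A.IsLogDerivation (LinearMap.toSpanSingleton ℂ _ A.defPoly ∘ₗ LinearMap.proj i)
      fun H => C (A.coeff H i) * d H := by
    intro H
    rw [mul_assoc, hd]
    simp [smul_eq_C_mul]
  have hmem : ∑ H, rename Sum.inl (C (A.coeff H i) * d H) * X (Sum.inr H) ∈ Q := by
    have := hQ (A.sum_mem_logIdeal hT)
    rw [Ideal.mem_comap] at this
    convert this using 1
    rw [map_sum]
    refine Finset.sum_congr rfl fun H _ => (weightRingEquiv l n).injective ?_
    rw [AlgEquiv.apply_symm_apply, map_mul, weightRingEquiv_rename_inl, weightRingEquiv_X_inr]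
  have h0 := hz _ hmem
  rw [map_sum] at h0
  rw [omegaAt, Finset.sum_apply, Pi.zero_apply]
  refine (mul_eq_zero.mp ?_).resolve_left hf
  refine Eq.trans ?_ h0
  rw [Finset.mul_sum]
  refine Finset.sum_congr rfl fun H _ => ?_
  have h1 : aeval z (rename Sum.inl (C (A.coeff H i) * d H) : MvPolynomial (Fin l ⊕ Fin n) ℂ) =
      A.coeff H i * eval (z ∘ Sum.inl) (d H) := by
    rw [aeval_rename, map_mul, aeval_C]
    rfl
  have h2 : aeval (z ∘ Sum.inl) A.defPoly =
      eval (z ∘ Sum.inl) (d H) * eval (z ∘ Sum.inl) (A.linForm H) := by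
    rw [← hd H]
    exact map_mul _ _ _
  rw [map_mul, h1, h2, aeval_X, Pi.smul_apply, smul_eq_mul, Function.comp_apply]
  field_simp [hform H]

/-- An overprime of the ideal generated by the values of logarithmic derivations either contains
the ideal of the critical variety, or contains the defining polynomial. -/
theorem C_defPoly_mem_of_notMem {Q : Ideal (MvPolynomial (Fin n) (CoordRing l))}
    (hprime : Q.IsPrime) (hQ : A.logIdeal ≤ Q) {G : MvPolynomial (Fin l ⊕ Fin n) ℂ}
    (hG : G ∈ vanishingIdeal ℂ A.critSet) (hGQ : weightRingEquiv l n G ∉ Q) :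
    C A.defPoly ∈ Q := by
  let Q' := Q.comap (weightRingEquiv l n)
  have hprime' : Q'.IsPrime := Ideal.comap_isPrime _ _
  have hQ' : A.logIdeal ≤ Q'.comap (weightRingEquiv l n).symm := fun τ hτ => by
    rw [Ideal.mem_comap, Ideal.mem_comap, AlgEquiv.apply_symm_apply]
    exact hQ hτ
  -- By the Nullstellensatz it is enough that `G f` vanishes on the zero locus of `Q'`. Off `f = 0`
  -- that locus lies in Σ, where `G` vanishes.
  have h : G * rename Sum.inl A.defPoly ∈ Q' := by
    rw [← IsPrime.vanishingIdeal_zeroLocus (K := ℂ) Q']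
    intro z hz
    rw [map_mul, aeval_rename]
    by_cases hf : aeval (z ∘ Sum.inl) A.defPoly = 0
    · rw [hf, mul_zero]
    · rw [hG z (A.mem_critSet hQ' hz hf), zero_mul]
  have := (hprime'.mem_or_mem h).resolve_left hGQ
  rwa [Ideal.mem_comap, weightRingEquiv_rename_inl] at this

variable {A} in
theorem IsTame.exists_pow_smul_mem_boundaries (htame : A.IsTame) (hess : A.IsEssential)
    {G : MvPolynomial (Fin l ⊕ Fin n) ℂ} (hG : G ∈ vanishingIdeal ℂ A.critSet) (p : ℕ) :
    ∃ m, ∀ z, weightedDiff A.dlogMul X p z = 0 →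
      weightRingEquiv l n G ^ m • z ∈ boundaries (weightedDiff A.dlogMul X) p := by
  refine _root_.exists_pow_smul_mem_boundaries _
    (weightedDiff_weightedDiff _ A.dlogMul_dlogMul A.dlogMul_dlogMul_self _)
    (fun q => hasProjectiveDimensionLE_baseChange _ q _ (htame.hasProjectiveDimensionLE q)) l
    (fun q hq => ?_) A.logIdeal (fun τ hτ q z hz => ?_) _
    (fun Q hprime hQ => A.containsWeaklyRegular_of_logIdeal_le hess Q hprime hQ)
    (fun Q hprime hQ hGQ => A.containsWeaklyRegular_succ_of_logIdeal_le hess Q hprime hQ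
      (A.C_defPoly_mem_of_notMem hprime hQ hG hGQ)) p
  · have : Subsingleton (A.logForms q) := by
      rw [A.logForms_eq_bot hq]
      infer_instance
    infer_instance
  · have : A.logIdeal ≤ ((boundaries (weightedDiff A.dlogMul X) q).colon {z}) := by
      refine Ideal.span_le.mpr ?_
      rintro _ ⟨T, c, hT, rfl⟩
      rw [SetLike.mem_coe, Submodule.mem_colon_singleton]
      exact contraction_smul_mem_boundaries A.dlogMul (A.logContraction hT) c
        (A.logContraction_dlogMul_zero hT) (A.logContraction_dlogMul hT) q z hz
    exact Submodule.mem_colon_singleton.mp (this hτ)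

end GenericWeights

/-! ### The complex for the weights `λ` and its relative subcomplex. -/

section SpecialWeights

/-- The differential `ω_λ ∧` on logarithmic forms. -/
noncomputable def logDiff (lam : Fin n → ℂ) (p : ℕ) :
    A.logForms p →ₗ[CoordRing l] A.logForms (p + 1) :=
  ∑ H, (C (lam H) : CoordRing l) • A.dlogMul H p

theorem logDiff_apply (lam : Fin n → ℂ) (p : ℕ) (z : A.logForms p) :
    A.logDiff lam p z = ∑ H, (C (lam H) : CoordRing l) • A.dlogMul H p z := by
  simp [logDiff, LinearMap.sum_apply]

theorem algebraMap_smul_eq_C_smul (a : ℂ) (x : RatForm l) :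
    algebraMap ℂ (RatFun l) a • x = (C a : CoordRing l) • x := by
  rw [IsScalarTower.algebraMap_apply ℂ (CoordRing l) (RatFun l), algebraMap_smul]
  rfl

theorem coe_logDiff (lam : Fin n → ℂ) (p : ℕ) (z : A.logForms p) :
    (A.logDiff lam p z : RatForm l) = A.wedgeOmega lam z := by
  rw [logDiff_apply, Submodule.coe_sum, wedgeOmega, LinearMap.mulLeft_apply, omega,
    Finset.sum_mul]
  refine Finset.sum_congr rfl fun H _ => ?_
  rw [Submodule.coe_smul, coe_dlogMul, smul_mul_assoc, algebraMap_smul_eq_C_smul]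

theorem wedgeOmega_wedgeOmega (lam : Fin n → ℂ) (x : RatForm l) :
    A.wedgeOmega lam (A.wedgeOmega lam x) = 0 := by
  have h : A.omega lam * A.omega lam = 0 := by
    rw [omega]
    simp only [dlog_eq_ι, ← map_smul, ← map_sum]
    exact ExteriorAlgebra.ι_sq_zero _
  rw [wedgeOmega, LinearMap.mulLeft_apply, LinearMap.mulLeft_apply, ← mul_assoc, h, zero_mul]

theorem logDiff_logDiff (lam : Fin n → ℂ) (p : ℕ) (z : A.logForms p) :
    A.logDiff lam (p + 1) (A.logDiff lam p z) = 0 := by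
  apply Subtype.ext
  rw [coe_logDiff, coe_logDiff, wedgeOmega_wedgeOmega, Submodule.coe_zero]

/-- The specialization of the weights to `λ`. -/
noncomputable def specialize (lam : Fin n → ℂ) :
    MvPolynomial (Fin l ⊕ Fin n) ℂ →ₐ[ℂ] CoordRing l :=
  aeval (Sum.elim X fun H => C (lam H))

theorem aeval_weightRingEquiv (lam : Fin n → ℂ) (G : MvPolynomial (Fin l ⊕ Fin n) ℂ) :
    aeval (fun H => (C (lam H) : CoordRing l)) (weightRingEquiv l n G) = specialize lam G := by
  have : ((aeval (fun H => (C (lam H) : CoordRing l))).restrictScalars ℂ).comp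
      (weightRingEquiv l n).toAlgHom = specialize lam := by
    refine MvPolynomial.algHom_ext ?_
    rintro (i | H)
    · simp [specialize, weightRingEquiv_X_inl]
    · simp [specialize, weightRingEquiv_X_inr]
  exact DFunLike.congr_fun this G

theorem aeval_specialize (lam : Fin n → ℂ) (x : Fin l → ℂ) (G : MvPolynomial (Fin l ⊕ Fin n) ℂ) :
    aeval x (specialize lam G) = aeval (Sum.elim x lam) G := by
  have : (aeval x).comp (specialize lam) = aeval (Sum.elim x lam) := by
    refine MvPolynomial.algHom_ext ?_
    rintro (i | H)
    · simp [specialize]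
    · simp [specialize]
  exact DFunLike.congr_fun this G

theorem critFiber_eq_zeroLocus (lam : Fin n → ℂ) : A.critFiber lam =
    zeroLocus ℂ ((vanishingIdeal ℂ A.critSet).map (specialize lam)) := by
  ext x
  rw [Ideal.map, zeroLocus_span]
  simp only [critFiber, critVariety, Set.mem_ofPred_eq, mem_zeroLocus_iff, Set.forall_mem_image,
    SetLike.mem_coe, aeval_specialize]

variable {A} in
/-- Functions vanishing on the fibre over `λ` of the critical variety have powers that kill the
cohomology of the complex of logarithmic forms. -/
theorem IsTame.vanishingIdeal_critFiber_le (htame : A.IsTame) (hess : A.IsEssential)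
    (lam : Fin n → ℂ) (p : ℕ) : vanishingIdeal ℂ (A.critFiber lam) ≤
      (Module.annihilator (CoordRing l) (cohomologyModule (A.logDiff lam) p)).radical := by
  -- The Nullstellensatz reduces the claim to specializations of functions `G` vanishing on Σ.
  rw [critFiber_eq_zeroLocus, vanishingIdeal_zeroLocus_eq_radical]
  refine (Ideal.radical_mono (Ideal.map_le_iff_le_comap.mpr fun G hG => ?_)).trans_eq
    (Ideal.radical_idem _)
  obtain ⟨m, hm⟩ := exists_pow_aeval_smul_mem_boundaries A.dlogMul A.dlogMul_dlogMul
    A.dlogMul_dlogMul_self (fun H => C (lam H)) (weightRingEquiv l n G)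
    (htame.exists_pow_smul_mem_boundaries hess hG) (A.logDiff lam) (A.logDiff_apply lam) p
  rw [aeval_weightRingEquiv] at hm
  exact ⟨m, (mem_annihilator_cohomologyModule _ _ _).mpr hm⟩

variable {A} in
/-- The complex of logarithmic forms is exact below the codimension of the critical fibre. -/
theorem IsTame.mem_boundaries_logDiff (htame : A.IsTame) (hess : A.IsEssential)
    (lam : Fin n → ℂ) (p : ℕ) (hp : (p : ℕ∞) < algCodim (A.critFiber lam))
    (z : A.logForms p) (hz : A.logDiff lam p z = 0) : z ∈ boundaries (A.logDiff lam) p := by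
  refine mem_boundaries_of_le_radical _ (A.logDiff_logDiff lam) htame.hasProjectiveDimensionLE
    (vanishingIdeal ℂ (A.critFiber lam)) (htame.vanishingIdeal_critFiber_le hess lam) p (p + 1)
    (Nat.lt_succ_self p) (fun Q hprime hQ => ?_) z hz
  refine containsWeaklyRegular_of_trdeg l Q (p + 1) (trdeg_add_le_of_le_height l Q (p + 1) ?_)
  refine le_trans ?_ (Ideal.height_mono hQ)
  exact_mod_cast Order.add_one_le_of_lt hp

/-- Contraction is an antiderivation, and it sends `ω_λ` to `∑ λ_H = 0`. -/
theorem eulerContraction_wedgeOmega {lam : Fin n → ℂ} (hlam : ∑ H, lam H = 0) (x : RatForm l) :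
    eulerContraction l (A.wedgeOmega lam x) = -A.wedgeOmega lam (eulerContraction l x) := by
  simp only [wedgeOmega, LinearMap.mulLeft_apply, omega, Finset.sum_mul, map_sum, smul_mul_assoc,
    map_smul, eulerContraction_dlog_mul, smul_sub, Finset.sum_sub_distrib]
  rw [← Finset.sum_smul, ← map_sum, hlam, map_zero, zero_smul, zero_sub]

theorem wedgeOmega_dlog_mul (lam : Fin n → ℂ) (H : Fin n) (x : RatForm l) :
    A.wedgeOmega lam (A.dlog H * x) = -(A.dlog H * A.wedgeOmega lam x) := by
  simp only [wedgeOmega, LinearMap.mulLeft_apply, omega, Finset.sum_mul, Finset.mul_sum,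
    smul_mul_assoc, mul_smul_comm, ← mul_assoc, A.dlog_mul_dlog _ H, neg_mul, smul_neg,
    Finset.sum_neg_distrib]

theorem eulerContraction_dlog_mul_mem_relLogForms (H : Fin n) {p : ℕ} {x : RatForm l}
    (hx : x ∈ A.logForms p) : eulerContraction l (A.dlog H * x) ∈ A.relLogForms p := by
  refine Submodule.mem_inf.mpr ⟨?_, eulerContraction_eulerContraction _⟩
  rw [eulerContraction_eq]
  exact A.contraction_mem_logForms A.isLogDerivation_linPoly (A.dlog_mul_mem_logForms H hx)

variable {A} in
-- The relative primitive in `mem_coboundaries` is built from some hyperplane. If there is none,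
-- essentiality forces `ℓ = 0` and no forms of positive degree exist.
theorem IsEssential.logForms_eq_bot_of_isEmpty [IsEmpty (Fin n)] (hess : A.IsEssential) (p : ℕ) :
    A.logForms (p + 1) = ⊥ := by
  refine A.logForms_eq_bot ?_
  have h : Module.finrank ℂ (Fin l → ℂ) = 0 := by
    rw [← finrank_top, ← hess, Set.range_eq_empty, Submodule.span_empty, finrank_bot]
  rw [Module.finrank_fin_fun] at h
  omega

/-- A relative form which is a coboundary of logarithmic forms is one of relative forms. -/
theorem mem_coboundaries (hess : A.IsEssential) {lam : Fin n → ℂ} (hlam : ∑ H, lam H = 0) {p : ℕ}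
    {z : RatForm l} (hz : z ∈ A.relLogForms p) {z' : A.logForms p} (hzz' : (z' : RatForm l) = z)
    (hz' : z' ∈ boundaries (A.logDiff lam) p) : z ∈ A.coboundaries lam p := by
  subst hzz'
  rcases p with _ | p
  · rw [(Submodule.mem_bot _).mp hz']
    exact zero_mem _
  · rcases isEmpty_or_nonempty (Fin n) with hn | ⟨⟨H⟩⟩
    · have h : (z' : RatForm l) = 0 :=
        (Submodule.eq_bot_iff _).mp (hess.logForms_eq_bot_of_isEmpty p) _ z'.2
      rw [h]
      exact zero_mem _
    · obtain ⟨y, rfl⟩ := hz'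
      rw [coe_logDiff] at hz ⊢
      -- The primitive `y` is replaced by `ι_χ(dα_H/α_H ∧ y)`, which is relative since `ι_χ² = 0`.
      -- Its image is again `ω_λ ∧ y`, because `ω_λ ∧` anticommutes with both operations and `ι_χ`
      -- kills `ω_λ ∧ y`.
      refine ⟨_, A.eulerContraction_dlog_mul_mem_relLogForms H y.2, ?_⟩
      have h : eulerContraction l (A.wedgeOmega lam y) = 0 := hz.2
      have h2 := A.eulerContraction_wedgeOmega hlam (A.dlog H * y)
      rw [wedgeOmega_dlog_mul, map_neg, eulerContraction_dlog_mul, h, mul_zero, sub_zero,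
        neg_inj] at h2
      exact h2.symm

end SpecialWeights

end CentralArrangement

theorem mainTheorem7 {l n : ℕ} (A : CentralArrangement l n) (hess : A.IsEssential)
    (htame : A.IsTame) (lam : Fin n → ℂ) (hlam : ∑ H, lam H = 0) (p : ℕ)
    (hcases : A.rank ≤ 4 ∨ A.IsFree ∨ p ≤ 2)
    (hcoh : Nontrivial (A.Cohomology lam p)) :
    algCodim (A.critFiber lam) ≤ (p : ℕ∞) := by
  by_contra! hp
  refine not_subsingleton (A.Cohomology lam p) ?_
  rw [Submodule.Quotient.subsingleton_iff, Submodule.submoduleOf_eq_top]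
  intro z hz
  refine A.mem_coboundaries hess hlam hz.1 (z' := ⟨z, hz.1.1⟩) rfl
    (htame.mem_boundaries_logDiff hess lam p hp _ (Subtype.ext ?_))
  rw [CentralArrangement.coe_logDiff]
  exact hz.2
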